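/- Let $a,b\in\mathbb C$ with $4a^3+27b^2\neq 0$, let $E$ be the elliptic curve $y^2=x^3+ax+b$ over $\mathbb C$ with zero point the point at infinity and with the differential $\omega=\frac{dx}{2y}$, let $Z\subset E(\mathbb C)$ be a finite subgroup, and put $Z_0=Z\setminus\{0\}$. For $p\in Z_0$ write $p=(x_p,y_p)$. For $p,q,r\in Z_0$ (not necessarily distinct) with $p+q+r=0$ there is a unique line $l_{p,q,r}$ with an equation $y+sx+t=0$ that meets $E$ in the divisor $[p]+[q]+[r]$; write its equation as $y+s_{p,q,r}x+t_{p,q,r}=0$ (so $s_{p,q,r}$ is minus the slope in the usual sense). There exists a unique map $Z_0\to\mathbb C$, $p\mapsto z_p$, such that (i) $z_p+z_{-p}=0$ for all $p\in Z_0$; (ii) $z_p+z_q+z_r=s_{p,q,r}$ for all $p,q,r\in Z_0$ with $p+q+r=0$. Moreover, (iii) $x_p+x_q+x_r=s_{p,q,r}^2$ for all $p,q,r\in Z_0$ with $p+q+r=0$. Finally, let $E'$ be an elliptic curve $y'^2=x'^3+a'x'+b'$ over $\mathbb C$ with $4a'^3+27b'^2\neq0$, and let $\rho:E'\to E$ be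 an isogeny such that $\rho^*\omega=\frac{dx'}{2y'}$. Then $\rho^{-1}(Z)$ is a finite subgroup of $E'(\mathbb C)$, and if $p'\mapsto z_{p'}$ denotes the map on $\rho^{-1}(Z)\setminus\{0\}$ that is characterized by (i) and (ii) for $E'$ and $\rho^{-1}(Z)$, then for every $p\in Z_0$ $$z_p=\sum_{p'\in\rho^{-1}(p)}z_{p'}.$$ -/

import Mathlib

open Polynomial
open scoped Polynomial.Bivariate

noncomputable section

namespace LineSlope

open WeierstrassCurve.Affine (CoordinateRing)

/-- The affine Weierstrass curve `y² = x³ + a x + b` over `ℂ`. -/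
def curve (a b : ℂ) : WeierstrassCurve.Affine ℂ := ⟨0, 0, 0, a, b⟩

variable {W W' : WeierstrassCurve.Affine ℂ}

/-- The `x`-coordinate of a point (only used for points other than `0`). -/
def xCoord : W.Point → ℂ
  | .zero => 0
  | .some x _ _ => x

/-- The ideal of functions in the affine coordinate ring that vanish at a given affine point
(the point `0` at infinity imposes no condition on the affine part). -/
def pointIdeal : W.Point → Ideal W.CoordinateRing
  | .zero => ⊤
  | .some x y _ => CoordinateRing.XYIdeal W x (C y)

/-- `CutsOut s t p q r`: the line `y + s x + t = 0` meets the curve exactly in the divisor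
`[p] + [q] + [r]` (with multiplicities), i.e. the ideal of the coordinate ring generated by
`y + s x + t` is the product of the ideals of `p`, `q`, `r`.  Such a line does not pass through the
point at infinity, so for affine points this describes the whole intersection. -/
def CutsOut (s t : ℂ) (p q r : W.Point) : Prop :=
  Ideal.span {CoordinateRing.mk W (Y + C (C s * X + C t))} =
    pointIdeal p * pointIdeal q * pointIdeal r

/-- `Z ∖ {0}`. -/
abbrev Punctured (Z : AddSubgroup W.Point) : Type := {p : W.Point // p ∈ Z ∧ p ≠ 0}

/-- The two defining properties of the function `p ↦ z_p` on `Z ∖ {0}`: it is odd, and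
`z_p + z_q + z_r` is the coefficient `s` of the line `y + s x + t = 0` cutting out
`[p] + [q] + [r]`, whenever `p + q + r = 0`. -/
structure IsSlopeFunction (Z : AddSubgroup W.Point) (z : Punctured Z → ℂ) : Prop where
  odd : ∀ p q : Punctured Z, (q : W.Point) = -(p : W.Point) → z p + z q = 0
  sum_eq : ∀ p q r : Punctured Z, (p : W.Point) + q + r = 0 →
    ∀ s t : ℂ, CutsOut s t (p : W.Point) q r → z p + z q + z r = s

/-- The coordinate function `x` in the function field. -/
def xFun (W : WeierstrassCurve.Affine ℂ) : W.FunctionField :=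
  algebraMap W.CoordinateRing W.FunctionField (CoordinateRing.mk W (C X))

/-- The coordinate function `y` in the function field. -/
def yFun (W : WeierstrassCurve.Affine ℂ) : W.FunctionField :=
  algebraMap W.CoordinateRing W.FunctionField (CoordinateRing.mk W Y)

/-- The rational function `f` is regular at the affine point `(u, v)` of the curve, with value `c`
there: `f = F / G` with polynomials `F`, `G` such that `G(u, v) ≠ 0` and `F(u, v) = c G(u, v)`. -/
def HasValueAt (f : W.FunctionField) (u v c : ℂ) : Prop :=
  ∃ F G : ℂ[X][Y], G.evalEval u v ≠ 0 ∧ F.evalEval u v = c * G.evalEval u v ∧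
    f * algebraMap W.CoordinateRing W.FunctionField (CoordinateRing.mk W G) =
      algebraMap W.CoordinateRing W.FunctionField (CoordinateRing.mk W F)

/-- `IsIsogeny ρ φ`: the homomorphism `ρ : W' → W` of groups of points is an isogeny, i.e. it is
given by a non-constant morphism of curves, and `φ` is the pullback of rational functions under this
morphism (an embedding of function fields over `ℂ`).  Concretely, an affine point `(u, v)` of `W'`
goes to the affine point `(c, d)` of `W` exactly when the pullbacks of `x` and `y` are regular at
`(u, v)` with values `c` and `d` (so it goes to `0` exactly when one of them has a pole). -/
def IsIsogeny (ρ : W'.Point →+ W.Point) (φ : W.FunctionField →ₐ[ℂ] W'.FunctionField) : Prop :=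
  ∀ (u v : ℂ) (h' : W'.Nonsingular u v) (c d : ℂ) (h : W.Nonsingular c d),
    ρ (.some u v h') = .some c d h ↔
      HasValueAt (φ (xFun W)) u v c ∧ HasValueAt (φ (yFun W)) u v d

/-- The differential `ω = dx / (2 y)`. -/
def omega (W : WeierstrassCurve.Affine ℂ) : KaehlerDifferential ℂ W.FunctionField :=
  (2 * yFun W)⁻¹ • KaehlerDifferential.D ℂ W.FunctionField (xFun W)

/-- The pullback `φ (ω) = d(φ x) / (2 φ y)` of `ω = dx / (2 y)` under a morphism with pullback of
functions `φ`. -/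
def pullbackOmega (φ : W.FunctionField →ₐ[ℂ] W'.FunctionField) :
    KaehlerDifferential ℂ W'.FunctionField :=
  (2 * φ (yFun W))⁻¹ • KaehlerDifferential.D ℂ W'.FunctionField (φ (xFun W))

end LineSlope

end

/-! Near every point of `E` there is a local parameter `t` with `ω = dt`. Expanding rational
functions in `t` at the origin gives `x = t⁻²(1 + O(t⁴))` and `y = -t⁻³(1 + O(t⁴))`. So the constant
term of the logarithmic derivative (`logCoeff`) is `-s` for `y + s x + t₀` and `0` for `x - c`
(`infinity_line`, `infinity_x_sub`). It is additive on products and kills nonzero constants, hence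
depends only on the divisor of a function.

Let `n` be the order of `Z`. For `p ∈ Z` the divisor `n[p] - n[0]` is principal, cut out by some
`g_p`, and `z_p = -logCoeff(g_p) / n`. Up to nonzero constants, `g_p g_{-p} = (x - x_p)ⁿ` and `g_p
g_q g_r = (y + s x + t₀)ⁿ`, which give (i) and (ii) (`isSlopeFunction_generatorSlope`). The
difference of two solutions, extended by `0`, is a homomorphism from the finite group `Z` to `ℂ`, so
it vanishes (`IsSlopeFunction.unique`). Property (iii) is the addition formula.

Since `ρ^*ω = ω'`, pullback carries the expansion at `ρ R` to the one at `R`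
(`expansionAt_comp_affine`, `expansionAt_comp_zero`). Let `n` now be the order of `ρ⁻¹(Z)` and `g_S`
the generators on `E'`. The pullback of the `n`-th power of a line is, up to a constant, the product
of the `g_S` over the three fibers, divided by the cube of the product over the nonzero kernel
points. The kernel contributes nothing to `logCoeff` by oddness, so the fiber sums of `z_{p'}`
satisfy (i) and (ii), and uniqueness finishes.

The expansions are constructed formally: `x' = 2y`, `y' = 3x² + a` is solved in power series, and at
infinity the equivalent system for `z = -x/y`, `w = -1/y`. -/

namespace LineSlope

/-! ### Formal planar differential equations in power series. -/

section FormalODE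

variable {k : Type*} [Field k]

lemma X_pow_dvd_derivative {n : ℕ} {f : PowerSeries k} (h : PowerSeries.X ^ (n + 1) ∣ f) :
    PowerSeries.X ^ n ∣ PowerSeries.derivative k f := by
  rw [PowerSeries.X_pow_dvd_iff] at h ⊢
  intro m hm
  rw [PowerSeries.coeff_derivative, h (m + 1) (by omega), zero_mul]

lemma X_pow_succ_dvd_of_derivative [CharZero k] {n : ℕ} {f : PowerSeries k}
    (h : PowerSeries.X ^ n ∣ PowerSeries.derivative k f)
    (h0 : PowerSeries.constantCoeff f = 0) : PowerSeries.X ^ (n + 1) ∣ f := by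
  rw [PowerSeries.X_pow_dvd_iff] at h ⊢
  intro m hm
  rcases m with _ | m
  · simpa using h0
  · have := h m (by omega)
    rw [PowerSeries.coeff_derivative] at this
    exact (mul_eq_zero.mp this).resolve_right (by exact_mod_cast m.succ_ne_zero)

lemma eq_of_forall_X_pow_dvd {f g : PowerSeries k} (h : ∀ n, PowerSeries.X ^ n ∣ f - g) :
    f = g := by
  ext n
  have := PowerSeries.X_pow_dvd_iff.mp (h (n + 1)) n n.lt_succ_self
  rwa [map_sub, sub_eq_zero] at this

/-- The antiderivative of a power series with constant coefficient `0`. -/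
noncomputable def antiderivative (f : PowerSeries k) : PowerSeries k :=
  -- The separate value at `n = 0` makes the truncated `n - 1` harmless and the constant term zero.
  PowerSeries.mk fun n => PowerSeries.coeff (n - 1) f * if n = 0 then 0 else (n : k)⁻¹

lemma derivative_antiderivative [CharZero k] (f : PowerSeries k) :
    PowerSeries.derivative k (antiderivative f) = f := by
  ext n
  have : (n : k) + 1 ≠ 0 := by exact_mod_cast n.succ_ne_zero
  simp [antiderivative, PowerSeries.coeff_derivative, this]

lemma constantCoeff_antiderivative (f : PowerSeries k) :
    PowerSeries.constantCoeff (antiderivative f) = 0 := by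
  rw [← PowerSeries.coeff_zero_eq_constantCoeff_apply]
  simp [antiderivative]

/-- A map of two power series is causal if it is non-expanding for the `X`-adic topology. -/
def Causal (F : PowerSeries k → PowerSeries k → PowerSeries k) : Prop :=
  ∀ (n : ℕ) (u v u' v' : PowerSeries k), PowerSeries.X ^ n ∣ u - u' → PowerSeries.X ^ n ∣ v - v' →
    PowerSeries.X ^ n ∣ F u v - F u' v'

/-- A formal planar system of differential equations has at most one solution with given initial
values. -/
theorem formal_solution_unique [CharZero k] {F G : PowerSeries k → PowerSeries k → PowerSeries k}
    (hF : Causal F) (hG : Causal G) {u v u' v' : PowerSeries k}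
    (hu : PowerSeries.derivative k u = F u v) (hv : PowerSeries.derivative k v = G u v)
    (hu' : PowerSeries.derivative k u' = F u' v') (hv' : PowerSeries.derivative k v' = G u' v')
    (h0 : PowerSeries.constantCoeff u = PowerSeries.constantCoeff u')
    (h0' : PowerSeries.constantCoeff v = PowerSeries.constantCoeff v') : u = u' ∧ v = v' := by
  -- Causality carries agreement modulo `X ^ n` to the derivatives, and integration gains one power
  -- of `X`.
  have key : ∀ n, PowerSeries.X ^ n ∣ u - u' ∧ PowerSeries.X ^ n ∣ v - v' := by
    intro n
    induction n with
    | zero => simp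
    | succ n ih =>
      refine ⟨X_pow_succ_dvd_of_derivative ?_ (by simp [h0]),
        X_pow_succ_dvd_of_derivative ?_ (by simp [h0'])⟩
      · rw [map_sub, hu, hu']; exact hF n _ _ _ _ ih.1 ih.2
      · rw [map_sub, hv, hv']; exact hG n _ _ _ _ ih.1 ih.2
  exact ⟨eq_of_forall_X_pow_dvd fun n => (key n).1, eq_of_forall_X_pow_dvd fun n => (key n).2⟩

/-- The Picard iterates of a formal planar system of differential equations. -/
noncomputable def picard (F G : PowerSeries k → PowerSeries k → PowerSeries k) (u₀ v₀ : k) :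
    ℕ → PowerSeries k × PowerSeries k
  | 0 => (PowerSeries.C u₀, PowerSeries.C v₀)
  | n + 1 =>
    (PowerSeries.C u₀ + antiderivative (F (picard F G u₀ v₀ n).1 (picard F G u₀ v₀ n).2),
      PowerSeries.C v₀ + antiderivative (G (picard F G u₀ v₀ n).1 (picard F G u₀ v₀ n).2))

/-- If consecutive terms of a sequence of power series agree to increasing order, the sequence has
a limit. -/
lemma exists_X_adic_limit (s : ℕ → PowerSeries k)
    (hs : ∀ n, PowerSeries.X ^ (n + 1) ∣ s (n + 1) - s n) :
    ∃ u, ∀ n, PowerSeries.X ^ (n + 1) ∣ u - s n := by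
  have h1 : ∀ i m, i ≤ m → PowerSeries.coeff i (s m) = PowerSeries.coeff i (s i) := by
    intro i m him
    induction m, him using Nat.le_induction with
    | base => rfl
    | succ m hm ih =>
      have := PowerSeries.X_pow_dvd_iff.mp (hs m) i (by omega)
      rw [map_sub, sub_eq_zero] at this
      rw [this, ih]
  refine ⟨PowerSeries.mk fun n => PowerSeries.coeff n (s n), fun n => ?_⟩
  rw [PowerSeries.X_pow_dvd_iff]
  intro m hm
  rw [map_sub, PowerSeries.coeff_mk, h1 m n (by omega), sub_self]

/-- A formal planar system of differential equations has a solution with given initial values. -/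
theorem exists_formal_solution [CharZero k] {F G : PowerSeries k → PowerSeries k → PowerSeries k}
    (hF : Causal F) (hG : Causal G) (u₀ v₀ : k) :
    ∃ u v : PowerSeries k, PowerSeries.constantCoeff u = u₀ ∧ PowerSeries.constantCoeff v = v₀ ∧
      PowerSeries.derivative k u = F u v ∧ PowerSeries.derivative k v = G u v := by
  set s := picard F G u₀ v₀ with hs
  have hs1 : ∀ n, (s (n + 1)).1 = PowerSeries.C u₀ + antiderivative (F (s n).1 (s n).2) :=
    fun n => rfl
  have hs2 : ∀ n, (s (n + 1)).2 = PowerSeries.C v₀ + antiderivative (G (s n).1 (s n).2) :=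
    fun n => rfl
  have c1 : ∀ n, PowerSeries.constantCoeff (s n).1 = u₀ := by
    intro n
    rcases n with _ | n
    · simp [hs, picard]
    · simp [hs1, constantCoeff_antiderivative]
  have c2 : ∀ n, PowerSeries.constantCoeff (s n).2 = v₀ := by
    intro n
    rcases n with _ | n
    · simp [hs, picard]
    · simp [hs2, constantCoeff_antiderivative]
  have d1 : ∀ n, PowerSeries.derivative k (s (n + 1)).1 = F (s n).1 (s n).2 := by
    intro n; rw [hs1, map_add, derivative_antiderivative, PowerSeries.derivative_C, zero_add]
  have d2 : ∀ n, PowerSeries.derivative k (s (n + 1)).2 = G (s n).1 (s n).2 := by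
    intro n; rw [hs2, map_add, derivative_antiderivative, PowerSeries.derivative_C, zero_add]
  have step : ∀ n, PowerSeries.X ^ (n + 1) ∣ (s (n + 1)).1 - (s n).1 ∧
      PowerSeries.X ^ (n + 1) ∣ (s (n + 1)).2 - (s n).2 := by
    intro n
    induction n with
    | zero =>
      exact ⟨X_pow_succ_dvd_of_derivative (by simp) (by rw [map_sub, c1, c1, sub_self]),
        X_pow_succ_dvd_of_derivative (by simp) (by rw [map_sub, c2, c2, sub_self])⟩
    | succ n ih =>
      refine ⟨X_pow_succ_dvd_of_derivative ?_ (by rw [map_sub, c1, c1, sub_self]),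
        X_pow_succ_dvd_of_derivative ?_ (by rw [map_sub, c2, c2, sub_self])⟩
      · rw [map_sub, d1, d1]; exact hF _ _ _ _ _ ih.1 ih.2
      · rw [map_sub, d2, d2]; exact hG _ _ _ _ _ ih.1 ih.2
  obtain ⟨u, hu⟩ := exists_X_adic_limit (fun n => (s n).1) fun n => (step n).1
  obtain ⟨v, hv⟩ := exists_X_adic_limit (fun n => (s n).2) fun n => (step n).2
  have e1 : PowerSeries.constantCoeff u = u₀ := by
    have := PowerSeries.X_pow_dvd_iff.mp (hu 0) 0 one_pos
    rwa [PowerSeries.coeff_zero_eq_constantCoeff_apply, map_sub, c1, sub_eq_zero] at this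
  have e2 : PowerSeries.constantCoeff v = v₀ := by
    have := PowerSeries.X_pow_dvd_iff.mp (hv 0) 0 one_pos
    rwa [PowerSeries.coeff_zero_eq_constantCoeff_apply, map_sub, c2, sub_eq_zero] at this
  refine ⟨u, v, e1, e2, eq_of_forall_X_pow_dvd fun n => ?_, eq_of_forall_X_pow_dvd fun n => ?_⟩
  -- Modulo `X ^ (n + 1)`, both `u'` and `F u v` agree with `F` at the `n`-th iterate.
  -- Differentiation loses one order, so `u` is compared with iterate `n + 1`.
  · have a1 := X_pow_dvd_derivative (hu (n + 1))
    have a2 := hF _ _ _ _ _ (hu n) (hv n)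
    rw [map_sub, d1] at a1
    refine (pow_dvd_pow _ n.le_succ).trans ?_
    convert dvd_sub a1 a2 using 1
    ring
  · have a1 := X_pow_dvd_derivative (hv (n + 1))
    have a2 := hG _ _ _ _ _ (hu n) (hv n)
    rw [map_sub, d2] at a1
    refine (pow_dvd_pow _ n.le_succ).trans ?_
    convert dvd_sub a1 a2 using 1
    ring

end FormalODE

/-! ### Differentiation of Laurent series. -/

section LaurentDerivation

open scoped LaurentSeries
open HahnSeries (single ofPowerSeries)

variable {k : Type*} [Field k]

lemma laurent_derivative_coeff (f : k⸨X⸩) (n : ℤ) :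
    (LaurentSeries.derivative k f).coeff n = (n + 1 : ℤ) • f.coeff (n + 1) := by
  simp

/-- Every Laurent series is a monomial times a power series, so this reduces the Leibniz rule for
`laurentD` to the one for power series. -/
lemma laurent_derivative_single_mul (m : ℤ) (f : PowerSeries k) :
    LaurentSeries.derivative k (single m 1 * ofPowerSeries ℤ k f) =
      single (m - 1) (m : k) * ofPowerSeries ℤ k f +
        single m 1 * ofPowerSeries ℤ k (PowerSeries.derivative k f) := by
  ext n
  rw [laurent_derivative_coeff, HahnSeries.coeff_add]
  have h1 : n + 1 = (n + 1 - m) + m := by ring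
  have h2 : n = (n + 1 - m) + (m - 1) := by ring
  have h3 : n = (n - m) + m := by ring
  rw [show (single m (1 : k) * ofPowerSeries ℤ k f).coeff (n + 1) =
      (ofPowerSeries ℤ k f).coeff (n + 1 - m) by
    conv_lhs => rw [h1, HahnSeries.coeff_single_mul_add, one_mul],
    show (single (m - 1) (m : k) * ofPowerSeries ℤ k f).coeff n =
      m * (ofPowerSeries ℤ k f).coeff (n + 1 - m) by
    conv_lhs => rw [h2, HahnSeries.coeff_single_mul_add],
    show (single m (1 : k) * ofPowerSeries ℤ k (PowerSeries.derivative k f)).coeff n =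
      (ofPowerSeries ℤ k (PowerSeries.derivative k f)).coeff (n - m) by
    conv_lhs => rw [h3, HahnSeries.coeff_single_mul_add, one_mul]]
  rw [PowerSeries.coeff_coe, PowerSeries.coeff_coe]
  split_ifs with h4 h5 h5
  · simp
  · omega
  · have : n + 1 - m = 0 := by omega
    simp only [this, Int.natAbs_zero, zsmul_eq_mul, add_zero]
    congr 1
    rw [show n + 1 = m by omega]
  · obtain ⟨i, hi⟩ : ∃ i : ℕ, n - m = i := ⟨(n - m).toNat, by omega⟩
    have h6 : n + 1 - m = (i + 1 : ℕ) := by push_cast; omega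
    rw [h6, hi, Int.natAbs_natCast, Int.natAbs_natCast, PowerSeries.coeff_derivative]
    have : ((n + 1 : ℤ) : k) = m + (i + 1) := by
      have : n + 1 = m + (i + 1) := by omega
      rw [this]; push_cast; ring
    rw [zsmul_eq_mul, this]
    ring

/-- Formal differentiation of Laurent series. -/
noncomputable def laurentD (k : Type*) [Field k] : k⸨X⸩ →+ k⸨X⸩ :=
  (LaurentSeries.derivative k).toAddMonoidHom

lemma laurentD_mul (f g : k⸨X⸩) : laurentD k (f * g) = f * laurentD k g + g * laurentD k f := by
  change LaurentSeries.derivative k (f * g) =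
    f * LaurentSeries.derivative k g + g * LaurentSeries.derivative k f
  obtain ⟨m, p, rfl⟩ : ∃ (m : ℤ) (p : PowerSeries k), f = single m 1 * ofPowerSeries ℤ k p :=
    ⟨_, _, (LaurentSeries.single_order_mul_powerSeriesPart f).symm⟩
  obtain ⟨n, q, rfl⟩ : ∃ (m : ℤ) (p : PowerSeries k), g = single m 1 * ofPowerSeries ℤ k p :=
    ⟨_, _, (LaurentSeries.single_order_mul_powerSeriesPart g).symm⟩
  have h0 : single (m + n) (1 : k) = single m 1 * single n 1 := by
    rw [HahnSeries.single_mul_single, one_mul]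
  have h : single m (1 : k) * ofPowerSeries ℤ k p * (single n 1 * ofPowerSeries ℤ k q) =
      single (m + n) 1 * ofPowerSeries ℤ k (p * q) := by
    rw [map_mul, h0]
    ring
  have h1 : single (m + n - 1) ((m + n : ℤ) : k) =
      single (m - 1) (m : k) * single n 1 + single (n - 1) (n : k) * single m 1 := by
    rw [HahnSeries.single_mul_single, HahnSeries.single_mul_single,
      show m - 1 + n = m + n - 1 by ring, show n - 1 + m = m + n - 1 by ring, mul_one, mul_one,
      Int.cast_add, HahnSeries.single_add]
  rw [h, laurent_derivative_single_mul, laurent_derivative_single_mul,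
    laurent_derivative_single_mul, Derivation.leibniz, h1, h0]
  simp only [smul_eq_mul, map_add, map_mul]
  ring

lemma laurentD_one : laurentD k 1 = 0 := by
  have := laurentD_mul (1 : k⸨X⸩) 1
  rw [mul_one, one_mul] at this
  exact left_eq_add.mp this

lemma laurentD_div (f : k⸨X⸩) {g : k⸨X⸩} (hg : g ≠ 0) :
    laurentD k (f / g) = (g * laurentD k f - f * laurentD k g) / g ^ 2 := by
  have h := laurentD_mul (f / g) g
  rw [div_mul_cancel₀ f hg] at h
  field_simp at h ⊢
  linear_combination -h

lemma laurentD_ofPowerSeries (f : PowerSeries k) :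
    laurentD k (ofPowerSeries ℤ k f) = ofPowerSeries ℤ k (PowerSeries.derivative k f) := by
  have := laurent_derivative_single_mul 0 f
  rw [Int.cast_zero, HahnSeries.single_eq_zero, zero_mul, zero_add,
    show HahnSeries.single (0 : ℤ) (1 : k) = 1 from rfl, one_mul, one_mul] at this
  exact this

lemma laurentD_C (c : k) : laurentD k (HahnSeries.C c) = 0 := by
  rw [← HahnSeries.ofPowerSeries_C, laurentD_ofPowerSeries, PowerSeries.derivative_C, map_zero]

end LaurentDerivation

open WeierstrassCurve.Affine (CoordinateRing)
open scoped LaurentSeries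
open HahnSeries (ofPowerSeries)

/-! ### Homomorphisms out of the coordinate ring. -/

section CoordinateRingHoms

variable {a b : ℂ} {A : Type*} [CommRing A]

/-- The ring homomorphism from the coordinate ring determined by a solution of the equation of the
curve. -/
noncomputable def coordHom (ι : ℂ →+* A) (u v : A) (h : v ^ 2 = u ^ 3 + ι a * u + ι b) :
    (curve a b).CoordinateRing →+* A :=
  AdjoinRoot.lift (eval₂RingHom ι u) v <| by
    simp [curve, WeierstrassCurve.Affine.polynomial, h, Polynomial.eval₂_pow]

section

variable (ι : ℂ →+* A) (u v : A) (h : v ^ 2 = u ^ 3 + ι a * u + ι b)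

lemma coordHom_const (c : ℂ) : coordHom ι u v h (CoordinateRing.mk _ (C (C c))) = ι c := by
  simp [coordHom, CoordinateRing.mk]

lemma coordHom_x : coordHom ι u v h (CoordinateRing.mk _ (C X)) = u := by
  simp [coordHom, CoordinateRing.mk]

lemma coordHom_y : coordHom ι u v h (CoordinateRing.mk _ Y) = v := by
  simp [coordHom, CoordinateRing.mk]

end

lemma coordinateRing_hom_ext {e e' : (curve a b).CoordinateRing →+* A}
    (hc : ∀ c : ℂ, e (CoordinateRing.mk _ (C (C c))) = e' (CoordinateRing.mk _ (C (C c))))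
    (hx : e (CoordinateRing.mk _ (C X)) = e' (CoordinateRing.mk _ (C X)))
    (hy : e (CoordinateRing.mk _ Y) = e' (CoordinateRing.mk _ Y)) : e = e' := by
  have : e.comp (CoordinateRing.mk (curve a b)) = e'.comp (CoordinateRing.mk (curve a b)) := by
    refine Polynomial.ringHom_ext' (Polynomial.ringHom_ext' ?_ hx) hy
    ext1 c
    exact hc c
  refine RingHom.ext fun f => ?_
  obtain ⟨F, rfl⟩ := AdjoinRoot.mk_surjective f
  exact RingHom.congr_fun this F

lemma coordinateRing_hom_apply_mk (e : (curve a b).CoordinateRing →+* ℂ)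
    (hc : ∀ c : ℂ, e (CoordinateRing.mk _ (C (C c))) = c) (F : ℂ[X][Y]) :
    e (CoordinateRing.mk _ F) =
      F.evalEval (e (CoordinateRing.mk _ (C X))) (e (CoordinateRing.mk _ Y)) := by
  have : e.comp (CoordinateRing.mk (curve a b)) =
      evalEvalRingHom (e (CoordinateRing.mk _ (C X))) (e (CoordinateRing.mk _ Y)) := by
    refine Polynomial.ringHom_ext' (Polynomial.ringHom_ext' ?_ ?_) ?_
    · ext1 c
      simpa using hc c
    · simp
    · simp
  exact RingHom.congr_fun this F

lemma coordinateRing_equation :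
    CoordinateRing.mk (curve a b) Y ^ 2 = CoordinateRing.mk (curve a b) (C X) ^ 3 +
      CoordinateRing.mk (curve a b) (C (C a)) * CoordinateRing.mk (curve a b) (C X) +
      CoordinateRing.mk (curve a b) (C (C b)) := by
  rw [← map_pow, ← map_pow, ← map_mul, ← map_add, ← map_add]
  refine AdjoinRoot.mk_eq_mk.mpr ⟨1, ?_⟩
  simp only [curve, WeierstrassCurve.Affine.polynomial, C_0, C_mul, C_add, C_pow]
  ring

/-- Every element of the coordinate ring divides a nonzero polynomial in `x`, unless it is `0`. -/
lemma exists_mul_eq_polynomial {f : (curve a b).CoordinateRing} (hf : f ≠ 0) :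
    ∃ (g : (curve a b).CoordinateRing) (N : ℂ[X]), N ≠ 0 ∧ f * g = CoordinateRing.mk _ (C N) := by
  have : Module.Finite ℂ[X] (curve a b).CoordinateRing := .of_basis (CoordinateRing.basis _)
  obtain ⟨p, q, rfl⟩ := CoordinateRing.exists_smul_basis_eq f
  -- The cofactor is the conjugate of `f` under negation on the curve, and `N` is the norm of `f`.
  refine ⟨CoordinateRing.mk _ (C p + C q *
    (-(Y : ℂ[X][Y]) - C (C (curve a b).a₁ * X + C (curve a b).a₃))), _,
    Algebra.norm_ne_zero_iff.mpr hf, ?_⟩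
  have := CoordinateRing.coe_norm_smul_basis (W' := curve a b) p q
  rw [map_mul] at this
  refine Eq.trans ?_ this.symm
  congr 1
  simp [CoordinateRing.smul]

/-- Over `ℂ` the polynomial splits into factors `X - c`, none of which `e` kills. -/
lemma hom_polynomial_ne_zero [IsDomain A] (e : ℂ[X] →+* A) (hx : ∀ c : ℂ, e X ≠ e (C c))
    {N : ℂ[X]} (hN : N ≠ 0) : e N ≠ 0 := by
  rw [(IsAlgClosed.splits N).eq_prod_roots, map_mul, map_multiset_prod]
  refine mul_ne_zero ?_ ?_
  · intro h
    have h1 : C N.leadingCoeff * C (N.leadingCoeff)⁻¹ = (1 : ℂ[X]) := by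
      rw [← C_mul, mul_inv_cancel₀ (leadingCoeff_ne_zero.mpr hN), C_1]
    have h2 := congrArg e h1
    rw [map_mul, h, zero_mul, map_one] at h2
    exact zero_ne_one h2
  · refine Multiset.prod_ne_zero ?_
    simp only [Multiset.map_map, Multiset.mem_map, Function.comp_apply, not_exists, not_and]
    intro c _ h
    rw [map_sub, sub_eq_zero] at h
    exact hx c h

lemma coordinateRing_hom_injective [IsDomain A] (e : (curve a b).CoordinateRing →+* A)
    (hx : ∀ c : ℂ, e (CoordinateRing.mk _ (C X)) ≠ e (CoordinateRing.mk _ (C (C c)))) :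
    Function.Injective e := by
  rw [injective_iff_map_eq_zero]
  intro f hf
  by_contra h
  obtain ⟨g, N, hN, hg⟩ := exists_mul_eq_polynomial h
  refine hom_polynomial_ne_zero ((e.comp (CoordinateRing.mk (curve a b))).comp C) hx hN ?_
  simp only [RingHom.comp_apply]
  rw [← hg, map_mul, hf, zero_mul]

end CoordinateRingHoms

instance laurent_charZero : CharZero ℂ⸨X⸩ :=
  charZero_of_injective_ringHom (f := (HahnSeries.C : ℂ →+* ℂ⸨X⸩)) HahnSeries.C_injective

/-! ### Power series or pole. -/

section LaurentCases

variable {k : Type*} [Field k]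

/-- The valuation ring dichotomy, with a pole recorded by an inverse in the maximal ideal so that
later arguments only compare constant terms. -/
lemma laurent_regular_or_pole (f : k⸨X⸩) : (∃ p : PowerSeries k, f = ofPowerSeries ℤ k p) ∨
    ∃ p : PowerSeries k, PowerSeries.constantCoeff p = 0 ∧ f * ofPowerSeries ℤ k p = 1 := by
  by_cases hf : f = 0
  · exact Or.inl ⟨0, by simp [hf]⟩
  set p := f.powerSeriesPart with hp
  have h := LaurentSeries.single_order_mul_powerSeriesPart f
  have h0 : PowerSeries.constantCoeff p ≠ 0 := by
    rw [← PowerSeries.coeff_zero_eq_constantCoeff_apply, hp, LaurentSeries.powerSeriesPart_coeff]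
    simpa using hf
  rcases lt_or_ge f.order 0 with hn | hn
  · right
    obtain ⟨n, hn'⟩ : ∃ n : ℕ, f.order = -(n + 1 : ℕ) := ⟨(-f.order - 1).toNat, by omega⟩
    refine ⟨PowerSeries.X ^ (n + 1) * p⁻¹, by simp, ?_⟩
    have h1 : ofPowerSeries ℤ k p * ofPowerSeries ℤ k p⁻¹ = 1 := by
      rw [← map_mul, PowerSeries.mul_inv_cancel p h0, map_one]
    rw [← h, map_mul, HahnSeries.ofPowerSeries_X_pow, hn',
      mul_mul_mul_comm, h1, HahnSeries.single_mul_single]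
    simp
  · left
    obtain ⟨n, hn'⟩ : ∃ n : ℕ, f.order = n := ⟨f.order.toNat, by omega⟩
    refine ⟨PowerSeries.X ^ n * p, ?_⟩
    rw [map_mul, HahnSeries.ofPowerSeries_X_pow, ← hn', h]

lemma ofPowerSeries_inj {p q : PowerSeries k} : ofPowerSeries ℤ k p = ofPowerSeries ℤ k q ↔ p = q :=
  HahnSeries.ofPowerSeries_injective.eq_iff

end LaurentCases

/-! ### Expansions in an additive parameter and their differential equations. -/

section Expansions

variable {a b : ℂ}

/-- A Laurent expansion of rational functions with respect to an additive local parameter, i.e. a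
homomorphism of the function field to the Laurent series under which the vector field dual to
`dx / (2 y)` becomes `d / dt`. -/
structure IsExpansion (e : (curve a b).FunctionField →+* ℂ⸨X⸩) : Prop where
  const : ∀ c : ℂ, e (algebraMap _ _ (CoordinateRing.mk (curve a b) (C (C c)))) = HahnSeries.C c
  deriv_x : laurentD ℂ (e (xFun _)) = 2 * e (yFun _)

/-- The expansion `e` is centered at the point `P`. -/
def IsCentered (e : (curve a b).FunctionField →+* ℂ⸨X⸩) : (curve a b).Point → Prop
  -- These are the coordinates `z = -x/y`, `w = -1/y`, in which the point at infinity is the origin.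
  | .zero => ∃ z w : PowerSeries ℂ, PowerSeries.constantCoeff z = 0 ∧
      PowerSeries.constantCoeff w = 0 ∧ e (xFun _) * ofPowerSeries ℤ ℂ w = ofPowerSeries ℤ ℂ z ∧
        e (yFun _) * ofPowerSeries ℤ ℂ w = -1
  | .some u v _ => ∃ p q : PowerSeries ℂ, PowerSeries.constantCoeff p = u ∧
      PowerSeries.constantCoeff q = v ∧ e (xFun _) = ofPowerSeries ℤ ℂ p ∧
        e (yFun _) = ofPowerSeries ℤ ℂ q

lemma functionField_hom_ext {L : Type*} [CommRing L] {e e' : (curve a b).FunctionField →+* L}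
    (hc : ∀ c : ℂ, e (algebraMap _ _ (CoordinateRing.mk (curve a b) (C (C c)))) =
      e' (algebraMap _ _ (CoordinateRing.mk (curve a b) (C (C c)))))
    (hx : e (xFun _) = e' (xFun _)) (hy : e (yFun _) = e' (yFun _)) : e = e' := by
  refine IsLocalization.ringHom_ext (nonZeroDivisors (curve a b).CoordinateRing) ?_
  exact coordinateRing_hom_ext hc hx hy

lemma functionField_equation : yFun (curve a b) ^ 2 = xFun (curve a b) ^ 3 +
    algebraMap _ _ (CoordinateRing.mk (curve a b) (C (C a))) * xFun (curve a b) +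
      algebraMap _ _ (CoordinateRing.mk (curve a b) (C (C b))) := by
  simpa only [xFun, yFun, map_pow, map_mul, map_add] using
    congrArg (algebraMap _ (curve a b).FunctionField) coordinateRing_equation

lemma yFun_ne_zero : yFun (curve a b) ≠ 0 := by
  have := CoordinateRing.YClass_ne_zero (W' := curve a b) 0
  rw [CoordinateRing.YClass, C_0, sub_zero] at this
  exact (map_ne_zero_iff _ (IsFractionRing.injective _ _)).mpr this

namespace IsExpansion

variable {e : (curve a b).FunctionField →+* ℂ⸨X⸩} (he : IsExpansion e)
include he

lemma equation : e (yFun _) ^ 2 = e (xFun _) ^ 3 + HahnSeries.C a * e (xFun _) + HahnSeries.C b := by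
  rw [← he.const a, ← he.const b, ← map_pow, ← map_pow, ← map_mul, ← map_add, ← map_add,
    functionField_equation]

lemma deriv_y : laurentD ℂ (e (yFun _)) = 3 * e (xFun _) ^ 2 + HahnSeries.C a := by
  have h := congrArg (laurentD ℂ) he.equation
  have hy : e (yFun _) ≠ 0 := (map_ne_zero e).mpr yFun_ne_zero
  simp only [pow_succ, pow_zero, one_mul, map_add, laurentD_mul, laurentD_C, he.deriv_x] at h
  have h2 : (2 * e (yFun _)) * (laurentD ℂ (e (yFun _)) - (3 * e (xFun _) ^ 2 + HahnSeries.C a)) =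
      0 := by
    linear_combination h
  have h3 := (mul_eq_zero.mp h2).resolve_left (mul_ne_zero two_ne_zero hy)
  exact sub_eq_zero.mp h3

/-- In the coordinates `z`, `w` the vector field has no pole at infinity: the system becomes
polynomial. -/
lemma infinity_equations {z w : ℂ⸨X⸩} (hz : e (xFun _) * w = z) (hw : e (yFun _) * w = -1) :
    laurentD ℂ z = 1 - 2 * HahnSeries.C a * z * w - 3 * HahnSeries.C b * w ^ 2 ∧
      laurentD ℂ w = 3 * z ^ 2 + HahnSeries.C a * w ^ 2 := by
  have hy : e (yFun _) ≠ 0 := (map_ne_zero e).mpr yFun_ne_zero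
  have h1 : laurentD ℂ w = 3 * z ^ 2 + HahnSeries.C a * w ^ 2 := by
    have h := congrArg (laurentD ℂ) hw
    rw [laurentD_mul, he.deriv_y, map_neg, laurentD_one, neg_zero] at h
    have h2 : e (yFun _) * (laurentD ℂ w - (3 * z ^ 2 + HahnSeries.C a * w ^ 2)) = 0 := by
      rw [← hz]
      linear_combination h - (3 * e (xFun _) ^ 2 + HahnSeries.C a) * w * hw
    exact sub_eq_zero.mp ((mul_eq_zero.mp h2).resolve_left hy)
  refine ⟨?_, h1⟩
  rw [← hz, laurentD_mul, h1, he.deriv_x, ← hz]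
  linear_combination -3 * w ^ 2 * he.equation + (2 + 3 * (e (yFun _) * w - 1)) * hw

end IsExpansion

end Expansions

/-! ### Existence and uniqueness of the expansion at each point. -/

section Existence

variable {a b : ℂ}

lemma equation_iff {u v : ℂ} : (curve a b).Equation u v ↔ v ^ 2 = u ^ 3 + a * u + b := by
  rw [WeierstrassCurve.Affine.equation_iff]
  simp [curve]

lemma nonsingular_iff {u v : ℂ} : (curve a b).Nonsingular u v ↔
    v ^ 2 = u ^ 3 + a * u + b ∧ (v ≠ 0 ∨ 3 * u ^ 2 + a ≠ 0) := by
  rw [WeierstrassCurve.Affine.nonsingular_iff, equation_iff]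
  simp only [curve]
  refine and_congr_right fun _ => ?_
  rw [or_comm]
  refine or_congr ?_ ?_
  · rw [not_iff_not]
    constructor <;> intro h
    · linear_combination h / 2
    · linear_combination 2 * h
  · rw [not_iff_not]
    constructor <;> intro h
    · linear_combination -h
    · linear_combination -h

variable [hab : Fact (4 * a ^ 3 + 27 * b ^ 2 ≠ 0)]

include hab in
lemma nonsingular_of_equation {u v : ℂ} (h : v ^ 2 = u ^ 3 + a * u + b) :
    (curve a b).Nonsingular u v := by
  rw [nonsingular_iff]
  refine ⟨h, ?_⟩
  by_contra! h'
  obtain ⟨h1, h2⟩ := h'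
  refine hab.out ?_
  have ha : a = -3 * u ^ 2 := by linear_combination h2
  have hb : b = 2 * u ^ 3 := by rw [h1, ha] at h; linear_combination -h
  rw [ha, hb]
  ring

omit hab in
lemma exists_functionField_hom {L : Type*} [Field L] (ι : ℂ →+* L) {U V : L}
    (h : V ^ 2 = U ^ 3 + ι a * U + ι b) (hU : ∀ c, U ≠ ι c) :
    ∃ e : (curve a b).FunctionField →+* L,
      (∀ c : ℂ, e (algebraMap _ _ (CoordinateRing.mk (curve a b) (C (C c)))) = ι c) ∧
        e (xFun _) = U ∧ e (yFun _) = V := by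
  have hinj : Function.Injective (coordHom (a := a) (b := b) ι U V h) := by
    refine coordinateRing_hom_injective _ fun c => ?_
    rw [coordHom_x, coordHom_const]
    exact hU c
  have hl : ∀ f, IsFractionRing.lift (K := (curve a b).FunctionField) hinj (algebraMap _ _ f) =
    coordHom (a := a) (b := b) ι U V h f := fun f => IsFractionRing.lift_algebraMap hinj f
  exact ⟨IsFractionRing.lift hinj, fun c => by rw [hl, coordHom_const],
    by rw [xFun, hl, coordHom_x], by rw [yFun, hl, coordHom_y]⟩

include hab in
-- A constant solution would be a stationary point of the vector field, that is, a singular point of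
-- the curve.
lemma solution_ne_const {U V : ℂ⸨X⸩} (h : V ^ 2 = U ^ 3 + HahnSeries.C a * U + HahnSeries.C b)
    (hU : laurentD ℂ U = 2 * V) (hV : laurentD ℂ V = 3 * U ^ 2 + HahnSeries.C a) (c : ℂ) :
    U ≠ HahnSeries.C c := by
  intro hc
  rw [hc, laurentD_C] at hU
  have hV0 : V = 0 := (mul_eq_zero.mp hU.symm).resolve_left two_ne_zero
  rw [hV0, hc, map_zero] at hV
  rw [hV0, hc] at h
  have h1 : (0 : ℂ) ^ 2 = c ^ 3 + a * c + b := by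
    apply HahnSeries.C_injective (Γ := ℤ)
    rw [map_add, map_add, map_mul, map_pow, map_pow, map_zero]
    exact h
  have h2 : 3 * c ^ 2 + a = 0 := by
    apply HahnSeries.C_injective (Γ := ℤ)
    rw [map_add, map_mul, map_pow, map_ofNat, map_zero]
    exact hV.symm
  exact ((nonsingular_iff.mp (nonsingular_of_equation h1)).2.resolve_left (by simp)) h2

include hab in
/-- A solution of the equation of the curve in Laurent series, compatible with the invariant
vector field, defines an expansion. -/
lemma exists_expansion {U V : ℂ⸨X⸩} (h : V ^ 2 = U ^ 3 + HahnSeries.C a * U + HahnSeries.C b)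
    (hU : laurentD ℂ U = 2 * V) (hV : laurentD ℂ V = 3 * U ^ 2 + HahnSeries.C a) :
    ∃ e : (curve a b).FunctionField →+* ℂ⸨X⸩, IsExpansion e ∧ e (xFun _) = U ∧ e (yFun _) = V := by
  obtain ⟨e, hc, hx, hy⟩ :=
    exists_functionField_hom (HahnSeries.C : ℂ →+* ℂ⸨X⸩) h (solution_ne_const h hU hV)
  exact ⟨e, ⟨hc, by rw [hx, hy, hU]⟩, hx, hy⟩

lemma causal_affine (c : ℂ) : Causal (fun _ v : PowerSeries ℂ => 2 * v) ∧
    Causal (fun u _ : PowerSeries ℂ => 3 * u ^ 2 + PowerSeries.C c) := by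
  refine ⟨fun n u v u' v' hu hv => ?_, fun n u v u' v' hu hv => ?_⟩
  · rw [← mul_sub]
    exact Dvd.dvd.mul_left hv _
  · have : 3 * u ^ 2 + PowerSeries.C c - (3 * u' ^ 2 + PowerSeries.C c) =
        (u - u') * (3 * (u + u')) := by ring
    rw [this]
    exact Dvd.dvd.mul_right hu _

lemma causal_infinity (c d : ℂ) :
    Causal (fun z w : PowerSeries ℂ =>
      1 - 2 * PowerSeries.C c * z * w - 3 * PowerSeries.C d * w ^ 2) ∧
    Causal (fun z w : PowerSeries ℂ => 3 * z ^ 2 + PowerSeries.C c * w ^ 2) := by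
  refine ⟨fun n u v u' v' hu hv => ?_, fun n u v u' v' hu hv => ?_⟩
  · have : 1 - 2 * PowerSeries.C c * u * v - 3 * PowerSeries.C d * v ^ 2 -
        (1 - 2 * PowerSeries.C c * u' * v' - 3 * PowerSeries.C d * v' ^ 2) =
        (u - u') * (-2 * PowerSeries.C c * v) +
          (v - v') * (-2 * PowerSeries.C c * u' - 3 * PowerSeries.C d * (v + v')) := by ring
    rw [this]
    exact dvd_add (Dvd.dvd.mul_right hu _) (Dvd.dvd.mul_right hv _)
  · have : 3 * u ^ 2 + PowerSeries.C c * v ^ 2 - (3 * u' ^ 2 + PowerSeries.C c * v' ^ 2) =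
        (u - u') * (3 * (u + u')) + (v - v') * (PowerSeries.C c * (v + v')) := by ring
    rw [this]
    exact dvd_add (Dvd.dvd.mul_right hu _) (Dvd.dvd.mul_right hv _)

omit hab in
lemma exists_affine_series {u v : ℂ} (h : v ^ 2 = u ^ 3 + a * u + b) :
    ∃ p q : PowerSeries ℂ, PowerSeries.constantCoeff p = u ∧ PowerSeries.constantCoeff q = v ∧
      PowerSeries.derivative ℂ p = 2 * q ∧
      PowerSeries.derivative ℂ q = 3 * p ^ 2 + PowerSeries.C a ∧
      q ^ 2 = p ^ 3 + PowerSeries.C a * p + PowerSeries.C b := by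
  obtain ⟨p, q, hp, hq, dp, dq⟩ :=
    exists_formal_solution (causal_affine a).1 (causal_affine a).2 u v
  refine ⟨p, q, hp, hq, dp, dq, ?_⟩
  -- The equation of the curve is a first integral: both sides have equal derivatives, so equality
  -- of constant terms suffices.
  apply PowerSeries.derivative.ext
  · simp only [pow_succ, pow_zero, one_mul, map_add, Derivation.leibniz, PowerSeries.derivative_C,
      dp, dq, smul_eq_mul, mul_zero, add_zero]
    ring
  · simp [hp, hq, h]

lemma exists_infinity_series (a b : ℂ) :
    ∃ z w : PowerSeries ℂ, PowerSeries.constantCoeff z = 0 ∧ PowerSeries.constantCoeff w = 0 ∧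
      PowerSeries.derivative ℂ z =
        1 - 2 * PowerSeries.C a * z * w - 3 * PowerSeries.C b * w ^ 2 ∧
      PowerSeries.derivative ℂ w = 3 * z ^ 2 + PowerSeries.C a * w ^ 2 ∧
      w = z ^ 3 + PowerSeries.C a * z * w ^ 2 + PowerSeries.C b * w ^ 3 ∧ w ≠ 0 := by
  obtain ⟨z, w, hz, hw, dz, dw⟩ :=
    exists_formal_solution (causal_infinity a b).1 (causal_infinity a b).2 0 0
  refine ⟨z, w, hz, hw, dz, dw, ?_, ?_⟩
  -- The right side has derivative `w' (z' + 2azw + 3bw²)`, and the bracket is `1` by the equation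
  -- for `z'`.
  · apply PowerSeries.derivative.ext
    · simp only [pow_succ, pow_zero, one_mul, map_add, Derivation.leibniz,
        PowerSeries.derivative_C, dz, dw, smul_eq_mul, mul_zero, add_zero]
      ring
    · simp [hz, hw]
  · rintro rfl
    have h3 : (3 : PowerSeries ℂ) ≠ 0 := by
      rw [← map_ofNat (PowerSeries.C (R := ℂ)) 3]
      exact (map_ne_zero_iff _ PowerSeries.C_injective).mpr three_ne_zero
    have h1 : z = 0 := by
      rw [map_zero, zero_pow two_ne_zero, mul_zero, add_zero, eq_comm, mul_eq_zero] at dw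
      exact pow_eq_zero_iff two_ne_zero |>.mp (dw.resolve_left h3)
    simp [h1] at dz

include hab in
theorem exists_isCentered (P : (curve a b).Point) :
    ∃ e : (curve a b).FunctionField →+* ℂ⸨X⸩, IsExpansion e ∧ IsCentered e P := by
  rcases P with _ | ⟨u, v, hP⟩
  · obtain ⟨z, w, hz, hw, dz, dw, h, h0⟩ := exists_infinity_series a b
    have H0 : ofPowerSeries ℤ ℂ w ≠ 0 :=
      (map_ne_zero_iff _ HahnSeries.ofPowerSeries_injective).mpr h0
    have H := congrArg (ofPowerSeries ℤ ℂ) h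
    have Dz := laurentD_ofPowerSeries z
    have Dw := laurentD_ofPowerSeries w
    rw [dz] at Dz
    rw [dw] at Dw
    simp only [map_add, map_sub, map_mul, map_pow, map_one, map_ofNat,
      HahnSeries.ofPowerSeries_C] at H Dz Dw
    obtain ⟨e, he, hx, hy⟩ := exists_expansion (a := a) (b := b)
      (U := ofPowerSeries ℤ ℂ z / ofPowerSeries ℤ ℂ w) (V := -1 / ofPowerSeries ℤ ℂ w)
      (by field_simp; linear_combination H)
      (by rw [laurentD_div _ H0, Dz, Dw]; field_simp; linear_combination 3 * H)
      (by rw [laurentD_div _ H0, Dw, map_neg, laurentD_one]; field_simp; ring)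
    exact ⟨e, he, z, w, hz, hw, by rw [hx]; field_simp, by rw [hy]; field_simp⟩
  · obtain ⟨p, q, hp, hq, dp, dq, h⟩ := exists_affine_series (nonsingular_iff.mp hP).1
    obtain ⟨e, he, hx, hy⟩ := exists_expansion (a := a) (b := b)
      (U := ofPowerSeries ℤ ℂ p) (V := ofPowerSeries ℤ ℂ q)
      (by simpa using congrArg (ofPowerSeries ℤ ℂ) h)
      (by rw [laurentD_ofPowerSeries, dp, map_mul, map_ofNat])
      (by rw [laurentD_ofPowerSeries, dq, map_add, map_mul, map_pow, map_ofNat,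
        HahnSeries.ofPowerSeries_C])
    exact ⟨e, he, p, q, hp, hq, hx, hy⟩

omit hab in
lemma IsExpansion.affine_equations {e : (curve a b).FunctionField →+* ℂ⸨X⸩} (he : IsExpansion e)
    {p q : PowerSeries ℂ} (hx : e (xFun _) = ofPowerSeries ℤ ℂ p)
    (hy : e (yFun _) = ofPowerSeries ℤ ℂ q) :
    PowerSeries.derivative ℂ p = 2 * q ∧
      PowerSeries.derivative ℂ q = 3 * p ^ 2 + PowerSeries.C a ∧
      q ^ 2 = p ^ 3 + PowerSeries.C a * p + PowerSeries.C b := by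
  refine ⟨?_, ?_, ?_⟩ <;> rw [← ofPowerSeries_inj]
  · rw [← laurentD_ofPowerSeries, ← hx, he.deriv_x, hy, map_mul, map_ofNat]
  · rw [← laurentD_ofPowerSeries, ← hy, he.deriv_y, hx, map_add, map_mul, map_pow, map_ofNat,
      HahnSeries.ofPowerSeries_C]
  · simpa [hx, hy] using he.equation

omit hab in
lemma IsExpansion.infinity_series_equations {e : (curve a b).FunctionField →+* ℂ⸨X⸩}
    (he : IsExpansion e) {z w : PowerSeries ℂ}
    (hz : e (xFun _) * ofPowerSeries ℤ ℂ w = ofPowerSeries ℤ ℂ z)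
    (hw : e (yFun _) * ofPowerSeries ℤ ℂ w = -1) :
    PowerSeries.derivative ℂ z = 1 - 2 * PowerSeries.C a * z * w - 3 * PowerSeries.C b * w ^ 2 ∧
      PowerSeries.derivative ℂ w = 3 * z ^ 2 + PowerSeries.C a * w ^ 2 := by
  obtain ⟨h1, h2⟩ := he.infinity_equations hz hw
  rw [laurentD_ofPowerSeries] at h1 h2
  refine ⟨?_, ?_⟩ <;> rw [← ofPowerSeries_inj]
  · rw [h1]
    simp only [map_sub, map_mul, map_pow, map_one, map_ofNat, HahnSeries.ofPowerSeries_C]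
  · rw [h2]
    simp only [map_add, map_mul, map_pow, map_ofNat, HahnSeries.ofPowerSeries_C]

omit hab in
-- The center prescribes the initial values of the differential system, which has only one solution.
theorem IsCentered.unique {e e' : (curve a b).FunctionField →+* ℂ⸨X⸩} (he : IsExpansion e)
    (he' : IsExpansion e') {P : (curve a b).Point} (hP : IsCentered e P) (hP' : IsCentered e' P) :
    e = e' := by
  have hc := fun c => (he.const c).trans (he'.const c).symm
  rcases P with _ | ⟨u, v, h⟩
  · obtain ⟨z, w, z0, w0, hz, hw⟩ := hP
    obtain ⟨z', w', z0', w0', hz', hw'⟩ := hP'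
    obtain ⟨d1, d2⟩ := he.infinity_series_equations hz hw
    obtain ⟨d1', d2'⟩ := he'.infinity_series_equations hz' hw'
    obtain ⟨rfl, rfl⟩ := formal_solution_unique (causal_infinity a b).1 (causal_infinity a b).2
      d1 d2 d1' d2' (z0.trans z0'.symm) (w0.trans w0'.symm)
    have H0 : ofPowerSeries ℤ ℂ w ≠ 0 := right_ne_zero_of_mul (hw ▸ neg_ne_zero.mpr one_ne_zero)
    exact functionField_hom_ext hc (mul_right_cancel₀ H0 (hz.trans hz'.symm))
      (mul_right_cancel₀ H0 (hw.trans hw'.symm))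
  · obtain ⟨p, q, p0, q0, hp, hq⟩ := hP
    obtain ⟨p', q', p0', q0', hp', hq'⟩ := hP'
    obtain ⟨d1, d2, -⟩ := he.affine_equations hp hq
    obtain ⟨d1', d2', -⟩ := he'.affine_equations hp' hq'
    obtain ⟨rfl, rfl⟩ := formal_solution_unique (causal_affine a).1 (causal_affine a).2
      d1 d2 d1' d2' (p0.trans p0'.symm) (q0.trans q0'.symm)
    exact functionField_hom_ext hc (hp.trans hp'.symm) (hq.trans hq'.symm)

include hab in
-- A valuative criterion: either `x` and `y` are both regular, or both have poles; mixed cases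
-- contradict the equation after clearing denominators and comparing constant terms. With two poles,
-- the equation forces `z` to be a power series vanishing at the origin.
theorem IsExpansion.exists_isCentered {e : (curve a b).FunctionField →+* ℂ⸨X⸩}
    (he : IsExpansion e) : ∃ P, IsCentered e P := by
  have heq := he.equation
  rcases laurent_regular_or_pole (e (xFun _)) with ⟨p, hp⟩ | ⟨p, p0, hp⟩
  · rcases laurent_regular_or_pole (e (yFun _)) with ⟨q, hq⟩ | ⟨q, q0, hq⟩
    · have h := (he.affine_equations hp hq).2.2
      refine ⟨.some (PowerSeries.constantCoeff p) (PowerSeries.constantCoeff q)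
        (nonsingular_of_equation ?_), p, q, rfl, rfl, hp, hq⟩
      simpa using congrArg PowerSeries.constantCoeff h
    · exfalso
      rw [hp] at heq
      have h1 : ofPowerSeries ℤ ℂ 1 =
          ofPowerSeries ℤ ℂ ((p ^ 3 + PowerSeries.C a * p + PowerSeries.C b) * q ^ 2) := by
        simp only [map_add, map_mul, map_pow, map_one, HahnSeries.ofPowerSeries_C]
        rw [← heq, ← mul_pow, hq, one_pow]
      have h2 := congrArg PowerSeries.constantCoeff (ofPowerSeries_inj.mp h1)
      simp [q0] at h2
  · rcases laurent_regular_or_pole (e (yFun _)) with ⟨q, hq⟩ | ⟨q, q0, hq⟩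
    · exfalso
      rw [hq] at heq
      have h1 : ofPowerSeries ℤ ℂ (1 + PowerSeries.C a * p ^ 2 + PowerSeries.C b * p ^ 3) =
          ofPowerSeries ℤ ℂ (q ^ 2 * p ^ 3) := by
        simp only [map_add, map_mul, map_pow, map_one, HahnSeries.ofPowerSeries_C]
        rw [heq]
        linear_combination (-(e (xFun _) * ofPowerSeries ℤ ℂ p) ^ 2 -
          (e (xFun _) * ofPowerSeries ℤ ℂ p) - 1 - HahnSeries.C a * (ofPowerSeries ℤ ℂ p) ^ 2) * hp
      have h2 := congrArg PowerSeries.constantCoeff (ofPowerSeries_inj.mp h1)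
      simp [p0] at h2
    · have hw : e (yFun _) * ofPowerSeries ℤ ℂ (-q) = -1 := by
        rw [map_neg]; linear_combination -hq
      have hE : ofPowerSeries ℤ ℂ (-q) = (e (xFun _) * ofPowerSeries ℤ ℂ (-q)) ^ 3 +
          HahnSeries.C a * (e (xFun _) * ofPowerSeries ℤ ℂ (-q)) * (ofPowerSeries ℤ ℂ (-q)) ^ 2 +
            HahnSeries.C b * (ofPowerSeries ℤ ℂ (-q)) ^ 3 := by
        linear_combination (ofPowerSeries ℤ ℂ (-q)) ^ 3 * heq -
          ofPowerSeries ℤ ℂ (-q) * (e (yFun _) * ofPowerSeries ℤ ℂ (-q) - 1) * hw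
      rcases laurent_regular_or_pole (e (xFun _) * ofPowerSeries ℤ ℂ (-q)) with
        ⟨z, hz⟩ | ⟨r, r0, hr⟩
      · refine ⟨0, z, -q, ?_, by simp [q0], hz, hw⟩
        have h1 : ofPowerSeries ℤ ℂ (-q) = ofPowerSeries ℤ ℂ
            (z ^ 3 + PowerSeries.C a * z * (-q) ^ 2 + PowerSeries.C b * (-q) ^ 3) := by
          rw [hz] at hE
          simpa only [map_add, map_mul, map_pow, HahnSeries.ofPowerSeries_C] using hE
        have h2 := congrArg PowerSeries.constantCoeff (ofPowerSeries_inj.mp h1)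
        simp only [map_add, map_mul, map_pow, map_neg, q0, neg_zero, ne_eq, OfNat.ofNat_ne_zero,
          not_false_eq_true, zero_pow, mul_zero, add_zero] at h2
        exact (pow_eq_zero_iff three_ne_zero).mp h2.symm
      · exfalso
        set w := ofPowerSeries ℤ ℂ (-q) with hwdef
        have h1 : ofPowerSeries ℤ ℂ ((-q) * r ^ 3) = ofPowerSeries ℤ ℂ
            (1 + PowerSeries.C a * (-q) ^ 2 * r ^ 2 + PowerSeries.C b * (-q) ^ 3 * r ^ 3) := by
          simp only [map_add, map_mul, map_pow, map_one, HahnSeries.ofPowerSeries_C]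
          rw [← hwdef]
          set s := ofPowerSeries ℤ ℂ r
          linear_combination s ^ 3 * hE + ((e (xFun _) * w * s) ^ 2 + (e (xFun _) * w * s) + 1 +
            HahnSeries.C a * w ^ 2 * s ^ 2) * hr
        have h2 := congrArg PowerSeries.constantCoeff (ofPowerSeries_inj.mp h1)
        simp [q0, r0] at h2

variable (P : (curve a b).Point)

/-- The Laurent expansion of rational functions at the point `P`. -/
noncomputable def expansionAt : (curve a b).FunctionField →+* ℂ⸨X⸩ :=
  (exists_isCentered P).choose

lemma isExpansion_expansionAt : IsExpansion (expansionAt P) :=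
  (exists_isCentered P).choose_spec.1

lemma isCentered_expansionAt : IsCentered (expansionAt P) P :=
  (exists_isCentered P).choose_spec.2

lemma IsCentered.eq_expansionAt {e : (curve a b).FunctionField →+* ℂ⸨X⸩} (he : IsExpansion e)
    {P : (curve a b).Point} (hP : IsCentered e P) : e = expansionAt P :=
  hP.unique he (isExpansion_expansionAt P) (isCentered_expansionAt P)

end Existence

/-! ### Orders and logarithmic derivatives of Laurent series. -/

section LaurentOrder

variable {k : Type*} [Field k]

lemma order_ofPowerSeries_nonneg (p : PowerSeries k) : 0 ≤ (ofPowerSeries ℤ k p).order := by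
  by_contra! h
  have h0 : ofPowerSeries ℤ k p ≠ 0 := by
    intro h0
    rw [h0, HahnSeries.order_zero] at h
    exact lt_irrefl _ h
  have h1 := HahnSeries.coeff_order_eq_zero.not.mpr h0
  rw [PowerSeries.coeff_coe, if_pos h] at h1
  exact h1 rfl

lemma order_ofPowerSeries_X_pow (n : ℕ) :
    (ofPowerSeries ℤ k (PowerSeries.X ^ n)).order = n := by
  rw [HahnSeries.ofPowerSeries_X_pow, HahnSeries.order_single one_ne_zero]

lemma order_ofPowerSeries_unit {p : PowerSeries k} (hp : IsUnit p) :
    (ofPowerSeries ℤ k p).order = 0 := by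
  obtain ⟨q, hq⟩ := hp.exists_right_inv
  have h := congrArg (ofPowerSeries ℤ k) hq
  rw [map_mul, map_one] at h
  have h1 := congrArg HahnSeries.order h
  rw [HahnSeries.order_mul (left_ne_zero_of_mul (h ▸ one_ne_zero))
    (right_ne_zero_of_mul (h ▸ one_ne_zero)), HahnSeries.order_one] at h1
  have := order_ofPowerSeries_nonneg p
  have := order_ofPowerSeries_nonneg q
  omega

lemma ofPowerSeries_ne_zero {p : PowerSeries k} (hp : p ≠ 0) : ofPowerSeries ℤ k p ≠ 0 :=
  (map_ne_zero_iff _ HahnSeries.ofPowerSeries_injective).mpr hp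

lemma order_ofPowerSeries_of_associated {p : PowerSeries k} {n : ℕ}
    (h : Associated p (PowerSeries.X ^ n)) : (ofPowerSeries ℤ k p).order = n := by
  obtain ⟨u, hu⟩ := h.symm
  rw [← hu, map_mul, HahnSeries.order_mul
    (ofPowerSeries_ne_zero (pow_ne_zero _ PowerSeries.X_ne_zero))
    (ofPowerSeries_ne_zero u.ne_zero), order_ofPowerSeries_X_pow,
    order_ofPowerSeries_unit u.isUnit, add_zero]

lemma order_ofPowerSeries_pos {p : PowerSeries k} (h0 : PowerSeries.constantCoeff p = 0)
    (hp : p ≠ 0) : 0 < (ofPowerSeries ℤ k p).order := by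
  obtain ⟨q, rfl⟩ := PowerSeries.X_dvd_iff.mpr h0
  have hX := order_ofPowerSeries_X_pow (k := k) 1
  rw [pow_one] at hX
  rw [map_mul, HahnSeries.order_mul (ofPowerSeries_ne_zero PowerSeries.X_ne_zero)
    (ofPowerSeries_ne_zero (right_ne_zero_of_mul hp)), hX]
  have := order_ofPowerSeries_nonneg q
  omega

lemma exists_ofPowerSeries_of_order_nonneg {f : k⸨X⸩} (h : 0 ≤ f.order) :
    ∃ p : PowerSeries k, f = ofPowerSeries ℤ k p := by
  rcases laurent_regular_or_pole f with h1 | ⟨p, p0, hp⟩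
  · exact h1
  · exfalso
    have hf : f ≠ 0 := left_ne_zero_of_mul (hp ▸ one_ne_zero)
    have hp0 : ofPowerSeries ℤ k p ≠ 0 := right_ne_zero_of_mul (hp ▸ one_ne_zero)
    have h1 := congrArg HahnSeries.order hp
    rw [HahnSeries.order_mul hf hp0, HahnSeries.order_one] at h1
    have := order_ofPowerSeries_pos p0 (by rintro rfl; simp at hp0)
    omega

/-- The constant coefficient of the logarithmic derivative of a Laurent series. -/
noncomputable def logCoeff (f : k⸨X⸩) : k := (laurentD k f / f).coeff 0

lemma logCoeff_mul {f g : k⸨X⸩} (hf : f ≠ 0) (hg : g ≠ 0) :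
    logCoeff (f * g) = logCoeff f + logCoeff g := by
  rw [logCoeff, logCoeff, logCoeff, ← HahnSeries.coeff_add, laurentD_mul]
  congr 1
  field_simp
  ring

lemma logCoeff_one : logCoeff (1 : k⸨X⸩) = 0 := by
  rw [logCoeff, laurentD_one, zero_div, HahnSeries.coeff_zero]

lemma logCoeff_C (c : k) : logCoeff (HahnSeries.C c : k⸨X⸩) = 0 := by
  rw [logCoeff, laurentD_C, zero_div, HahnSeries.coeff_zero]

lemma logCoeff_pow {f : k⸨X⸩} (hf : f ≠ 0) (n : ℕ) : logCoeff (f ^ n) = n * logCoeff f := by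
  induction n with
  | zero => rw [pow_zero, logCoeff_one, Nat.cast_zero, zero_mul]
  | succ n ih => rw [pow_succ, logCoeff_mul (pow_ne_zero n hf) hf, ih]; push_cast; ring

lemma logCoeff_prod {ι : Type*} (s : Finset ι) (f : ι → k⸨X⸩) (hf : ∀ i ∈ s, f i ≠ 0) :
    logCoeff (∏ i ∈ s, f i) = ∑ i ∈ s, logCoeff (f i) := by
  classical
  induction s using Finset.induction_on with
  | empty => rw [Finset.prod_empty, Finset.sum_empty, logCoeff_one]
  | insert i s hi ih =>
    rw [Finset.prod_insert hi, Finset.sum_insert hi, logCoeff_mul (hf i (Finset.mem_insert_self i s))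
      (Finset.prod_ne_zero_iff.mpr fun j hj => hf j (Finset.mem_insert_of_mem hj)),
      ih fun j hj => hf j (Finset.mem_insert_of_mem hj)]

lemma order_prod {ι : Type*} (s : Finset ι) (f : ι → k⸨X⸩) (hf : ∀ i ∈ s, f i ≠ 0) :
    (∏ i ∈ s, f i).order = ∑ i ∈ s, (f i).order := by
  classical
  induction s using Finset.induction_on with
  | empty => rw [Finset.prod_empty, Finset.sum_empty, HahnSeries.order_one]
  | insert i s hi ih =>
    rw [Finset.prod_insert hi, Finset.sum_insert hi,
      HahnSeries.order_mul (hf i (Finset.mem_insert_self i s))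
      (Finset.prod_ne_zero_iff.mpr fun j hj => hf j (Finset.mem_insert_of_mem hj)),
      ih fun j hj => hf j (Finset.mem_insert_of_mem hj)]

lemma logCoeff_ofPowerSeries {p : PowerSeries k} (hp : PowerSeries.constantCoeff p ≠ 0) :
    logCoeff (ofPowerSeries ℤ k p) = PowerSeries.coeff 1 p / PowerSeries.constantCoeff p := by
  have h0 : ofPowerSeries ℤ k p ≠ 0 := ofPowerSeries_ne_zero (by rintro rfl; simp at hp)
  have h : laurentD k (ofPowerSeries ℤ k p) / ofPowerSeries ℤ k p =
      ofPowerSeries ℤ k (PowerSeries.derivative k p * p⁻¹) := by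
    rw [div_eq_iff h0, ← map_mul, mul_assoc, PowerSeries.inv_mul_cancel p hp, mul_one,
      laurentD_ofPowerSeries]
  rw [logCoeff, h]
  have h1 := LaurentSeries.coeff_coe_powerSeries (PowerSeries.derivative k p * p⁻¹) 0
  rw [Nat.cast_zero] at h1
  rw [h1, PowerSeries.coeff_zero_eq_constantCoeff_apply, map_mul,
    ← PowerSeries.coeff_zero_eq_constantCoeff_apply (PowerSeries.derivative k p),
    PowerSeries.coeff_derivative, PowerSeries.constantCoeff_inv]
  simp [div_eq_mul_inv]

lemma logCoeff_X : logCoeff (ofPowerSeries ℤ k PowerSeries.X) = 0 := by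
  rw [logCoeff, laurentD_ofPowerSeries, PowerSeries.derivative_X, map_one,
    HahnSeries.ofPowerSeries_X]
  have : (1 : k⸨X⸩) / HahnSeries.single 1 1 = HahnSeries.single (-1) 1 := by
    rw [div_eq_iff (HahnSeries.single_ne_zero one_ne_zero), HahnSeries.single_mul_single]
    simp
  rw [this, HahnSeries.coeff_single_of_ne (by decide)]

/-- A Laurent series which becomes a unit power series after multiplication by a power of the
variable and a power series `1 + O(X²)`. -/
lemma order_and_logCoeff_of_mul_eq {f : k⸨X⸩} {n : ℕ} {p q : PowerSeries k}
    (hp : PowerSeries.constantCoeff p = 1) (hp1 : PowerSeries.coeff 1 p = 0)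
    (hq : PowerSeries.constantCoeff q ≠ 0)
    (h : f * ofPowerSeries ℤ k (PowerSeries.X ^ n * p) = ofPowerSeries ℤ k q) :
    f.order = -n ∧ logCoeff f = PowerSeries.coeff 1 q / PowerSeries.constantCoeff q := by
  have hp' : PowerSeries.constantCoeff p ≠ 0 := hp ▸ one_ne_zero
  have hX : ofPowerSeries ℤ k PowerSeries.X ≠ 0 := ofPowerSeries_ne_zero PowerSeries.X_ne_zero
  have hq0 : ofPowerSeries ℤ k q ≠ 0 := ofPowerSeries_ne_zero (by rintro rfl; simp at hq)
  have hp0 : ofPowerSeries ℤ k p ≠ 0 := ofPowerSeries_ne_zero (by rintro rfl; simp at hp')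
  rw [map_mul, map_pow] at h
  have hf : f ≠ 0 := left_ne_zero_of_mul (h ▸ hq0)
  constructor
  · have h1 := congrArg HahnSeries.order h
    rw [HahnSeries.order_mul hf (mul_ne_zero (pow_ne_zero _ hX) hp0),
      HahnSeries.order_mul (pow_ne_zero _ hX) hp0, ← map_pow, order_ofPowerSeries_X_pow,
      order_ofPowerSeries_unit (PowerSeries.isUnit_iff_constantCoeff.mpr hp'.isUnit),
      order_ofPowerSeries_unit (PowerSeries.isUnit_iff_constantCoeff.mpr hq.isUnit)] at h1
    omega
  · have h1 := congrArg logCoeff h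
    rw [logCoeff_mul hf (mul_ne_zero (pow_ne_zero _ hX) hp0),
      logCoeff_mul (pow_ne_zero _ hX) hp0, logCoeff_pow hX, logCoeff_X, logCoeff_ofPowerSeries hp',
      logCoeff_ofPowerSeries hq, hp1] at h1
    simpa using h1

end LaurentOrder

/-! ### Expansions at the origin of the group. -/

section Infinity

variable {a b : ℂ} [hab : Fact (4 * a ^ 3 + 27 * b ^ 2 ≠ 0)]

omit hab in
-- Bootstrapping through the differential equations: first `w = O(t³)`, then `z = t + O(t⁵)`, then
-- `w = t³ + O(t⁷)`. The gap after the leading terms keeps them from contributing to `logCoeff`.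
lemma infinity_series_expand {z w : PowerSeries ℂ} (z0 : PowerSeries.constantCoeff z = 0)
    (w0 : PowerSeries.constantCoeff w = 0)
    (dz : PowerSeries.derivative ℂ z =
      1 - 2 * PowerSeries.C a * z * w - 3 * PowerSeries.C b * w ^ 2)
    (dw : PowerSeries.derivative ℂ w = 3 * z ^ 2 + PowerSeries.C a * w ^ 2) :
    ∃ p q : PowerSeries ℂ, z = PowerSeries.X * (1 + PowerSeries.X ^ 4 * p) ∧
      w = PowerSeries.X ^ 3 * (1 + PowerSeries.X ^ 4 * q) := by
  obtain ⟨z₁, hz⟩ := PowerSeries.X_dvd_iff.mpr z0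
  obtain ⟨w₁, hw⟩ := PowerSeries.X_dvd_iff.mpr w0
  obtain ⟨w₂, hw2⟩ : PowerSeries.X ^ 3 ∣ w := by
    refine X_pow_succ_dvd_of_derivative ⟨3 * z₁ ^ 2 + PowerSeries.C a * w₁ ^ 2, ?_⟩ w0
    rw [dw, hz, hw]
    ring
  obtain ⟨p, hp⟩ : PowerSeries.X ^ 5 ∣ z - PowerSeries.X := by
    refine X_pow_succ_dvd_of_derivative
      ⟨- 2 * PowerSeries.C a * z₁ * w₂ - 3 * PowerSeries.C b * PowerSeries.X ^ 2 * w₂ ^ 2, ?_⟩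
      (by simp [z0])
    rw [map_sub, PowerSeries.derivative_X, dz, hw2, hz]
    ring
  obtain ⟨q, hq⟩ : PowerSeries.X ^ 7 ∣ w - PowerSeries.X ^ 3 := by
    refine X_pow_succ_dvd_of_derivative
      ⟨3 * p * (2 + PowerSeries.X ^ 4 * p) + PowerSeries.C a * w₂ ^ 2, ?_⟩
      (by simp [w0])
    have hz' : z = PowerSeries.X + PowerSeries.X ^ 5 * p := by rw [← hp]; ring
    rw [map_sub, dw, hw2, hz', Derivation.leibniz_pow, PowerSeries.derivative_X]
    simp only [smul_eq_mul, nsmul_eq_mul]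
    push_cast
    ring
  exact ⟨p, q, by linear_combination hp, by linear_combination hq⟩

lemma expansionAt_zero_spec : ∃ p q : PowerSeries ℂ,
    expansionAt (0 : (curve a b).Point) (xFun _) *
        ofPowerSeries ℤ ℂ (PowerSeries.X ^ 2 * (1 + PowerSeries.X ^ 4 * q)) =
      ofPowerSeries ℤ ℂ (1 + PowerSeries.X ^ 4 * p) ∧
    expansionAt (0 : (curve a b).Point) (yFun _) *
        ofPowerSeries ℤ ℂ (PowerSeries.X ^ 3 * (1 + PowerSeries.X ^ 4 * q)) = -1 := by
  obtain ⟨z, w, z0, w0, hz, hw⟩ := isCentered_expansionAt (0 : (curve a b).Point)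
  obtain ⟨dz, dw⟩ := (isExpansion_expansionAt _).infinity_series_equations hz hw
  obtain ⟨p, q, hp, hq⟩ := infinity_series_expand z0 w0 dz dw
  refine ⟨p, q, ?_, hq ▸ hw⟩
  have hX : ofPowerSeries ℤ ℂ PowerSeries.X ≠ 0 := ofPowerSeries_ne_zero PowerSeries.X_ne_zero
  apply mul_left_cancel₀ hX
  rw [← map_mul, ← hp, ← hz, hq, mul_left_comm, ← map_mul]
  congr 2
  ring

lemma expansionAt_const (P : (curve a b).Point) (c : ℂ) : expansionAt P
    (algebraMap _ _ (CoordinateRing.mk (curve a b) (C (C c)))) = HahnSeries.C c :=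
  (isExpansion_expansionAt P).const c

/-- Order and constant coefficient of the logarithmic derivative of `x - c` at infinity. -/
lemma infinity_x_sub (c : ℂ) :
    (expansionAt (0 : (curve a b).Point) (algebraMap _ _
      (CoordinateRing.mk (curve a b) (C (X - C c))))).order = -2 ∧
    logCoeff (expansionAt (0 : (curve a b).Point) (algebraMap _ _
      (CoordinateRing.mk (curve a b) (C (X - C c))))) = 0 := by
  obtain ⟨p, q, hx, -⟩ := expansionAt_zero_spec (a := a) (b := b)
  have hq : PowerSeries.coeff 1 (1 + PowerSeries.X ^ 4 * q) = 0 := by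
    simp [PowerSeries.coeff_X_pow_mul', PowerSeries.coeff_one]
  have h := order_and_logCoeff_of_mul_eq (p := 1 + PowerSeries.X ^ 4 * q)
    (q := 1 + PowerSeries.X ^ 4 * p - PowerSeries.C c * PowerSeries.X ^ 2 *
      (1 + PowerSeries.X ^ 4 * q)) (n := 2)
    (f := expansionAt (0 : (curve a b).Point) (algebraMap _ _
      (CoordinateRing.mk (curve a b) (C (X - C c))))) (by simp) hq (by simp) (by
        rw [C_sub, map_sub, map_sub, map_sub, expansionAt_const, sub_mul,
          map_sub (ofPowerSeries ℤ ℂ), ← hx]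
        simp only [map_mul, HahnSeries.ofPowerSeries_C, xFun]
        ring)
  refine ⟨h.1, h.2.trans ?_⟩
  rw [div_eq_zero_iff]
  left
  have : PowerSeries.C c * PowerSeries.X ^ 2 * (1 + PowerSeries.X ^ 4 * q) =
    PowerSeries.X ^ 2 * (PowerSeries.C c * (1 + PowerSeries.X ^ 4 * q)) := by ring
  rw [map_sub, map_add, this]
  simp [PowerSeries.coeff_X_pow_mul', PowerSeries.coeff_one]

/-- Order and constant coefficient of the logarithmic derivative of `y + s x + t` at infinity. -/
lemma infinity_line (s t : ℂ) :
    (expansionAt (0 : (curve a b).Point) (algebraMap _ _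
      (CoordinateRing.mk (curve a b) (Y + C (C s * X + C t))))).order = -3 ∧
    logCoeff (expansionAt (0 : (curve a b).Point) (algebraMap _ _
      (CoordinateRing.mk (curve a b) (Y + C (C s * X + C t))))) = -s := by
  obtain ⟨p, q, hx, hy⟩ := expansionAt_zero_spec (a := a) (b := b)
  have hq : PowerSeries.coeff 1 (1 + PowerSeries.X ^ 4 * q) = 0 := by
    simp [PowerSeries.coeff_X_pow_mul', PowerSeries.coeff_one]
  -- Multiplied by `t³(1 + O(t⁴))`, the line becomes `-1 + s t + O(t³)`, whose logarithmic
  -- derivative has constant term `-s`.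
  have h := order_and_logCoeff_of_mul_eq (p := 1 + PowerSeries.X ^ 4 * q)
    (q := -1 + PowerSeries.C s * PowerSeries.X * (1 + PowerSeries.X ^ 4 * p) +
      PowerSeries.C t * PowerSeries.X ^ 3 * (1 + PowerSeries.X ^ 4 * q)) (n := 3)
    (f := expansionAt (0 : (curve a b).Point) (algebraMap _ _
      (CoordinateRing.mk (curve a b) (Y + C (C s * X + C t))))) (by simp) hq (by simp) (by
        rw [map_add, map_add, map_add, C_add, C_mul, map_add, map_add, map_add, map_mul, map_mul,
          map_mul, expansionAt_const, expansionAt_const]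
        change (expansionAt 0 (yFun _) + (_ * expansionAt 0 (xFun _) + _)) * _ = _
        rw [add_mul, hy, add_mul]
        have h2 : ofPowerSeries ℤ ℂ (PowerSeries.X ^ 3 * (1 + PowerSeries.X ^ 4 * q)) =
          ofPowerSeries ℤ ℂ PowerSeries.X *
            ofPowerSeries ℤ ℂ (PowerSeries.X ^ 2 * (1 + PowerSeries.X ^ 4 * q)) := by
          rw [← map_mul]
          congr 1
          ring
        have h3 : ofPowerSeries ℤ ℂ (-1 + PowerSeries.C s * PowerSeries.X *
            (1 + PowerSeries.X ^ 4 * p) + PowerSeries.C t * PowerSeries.X ^ 3 *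
              (1 + PowerSeries.X ^ 4 * q)) = -1 + HahnSeries.C s *
            ofPowerSeries ℤ ℂ PowerSeries.X * ofPowerSeries ℤ ℂ (1 + PowerSeries.X ^ 4 * p) +
            HahnSeries.C t * ofPowerSeries ℤ ℂ
              (PowerSeries.X ^ 3 * (1 + PowerSeries.X ^ 4 * q)) := by
          rw [map_add, map_add, map_mul, map_mul, map_neg, map_one, HahnSeries.ofPowerSeries_C,
            mul_assoc (PowerSeries.C t), map_mul (ofPowerSeries ℤ ℂ) (PowerSeries.C t),
            HahnSeries.ofPowerSeries_C]
        rw [h3, ← hx, h2]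
        ring)
  refine ⟨h.1, h.2.trans ?_⟩
  have e1 : PowerSeries.C s * PowerSeries.X * (1 + PowerSeries.X ^ 4 * p) =
    PowerSeries.X ^ 1 * (PowerSeries.C s * (1 + PowerSeries.X ^ 4 * p)) := by ring
  have e2 : PowerSeries.C t * PowerSeries.X ^ 3 * (1 + PowerSeries.X ^ 4 * q) =
    PowerSeries.X ^ 3 * (PowerSeries.C t * (1 + PowerSeries.X ^ 4 * q)) := by ring
  have e3 : (-1 : PowerSeries ℂ) = PowerSeries.C (-1) := by simp
  rw [e1, e2, e3, map_add, map_add, map_add, map_add, PowerSeries.coeff_X_pow_mul',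
    PowerSeries.coeff_X_pow_mul', PowerSeries.coeff_C]
  simp [div_neg]

end Infinity

/-! ### Local rings at affine points. -/

section AffineOrders

variable {a b : ℂ} [hab : Fact (4 * a ^ 3 + 27 * b ^ 2 ≠ 0)]

/-- `1` if the two points agree and `0` otherwise. -/
noncomputable def mult {W : WeierstrassCurve.Affine ℂ} (P A : W.Point) : ℕ :=
  open Classical in if P = A then 1 else 0

/-- The power series expansion of regular functions at an affine point. -/
structure IsSeriesAt {u v : ℂ} (h : (curve a b).Nonsingular u v)
    (ε : (curve a b).CoordinateRing →+* PowerSeries ℂ) : Prop where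
  coe : ∀ f, ofPowerSeries ℤ ℂ (ε f) = expansionAt (.some u v h) (algebraMap _ _ f)
  constantCoeff : ∀ F : ℂ[X][Y], PowerSeries.constantCoeff (ε (CoordinateRing.mk _ F)) =
    F.evalEval u v
  const : ∀ c : ℂ, ε (CoordinateRing.mk _ (C (C c))) = PowerSeries.C c
  deriv_x : PowerSeries.derivative ℂ (ε (CoordinateRing.mk _ (C X))) =
    2 * ε (CoordinateRing.mk _ Y)
  deriv_y : PowerSeries.derivative ℂ (ε (CoordinateRing.mk _ Y)) =
    3 * ε (CoordinateRing.mk _ (C X)) ^ 2 + PowerSeries.C a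

variable {u v : ℂ} {h : (curve a b).Nonsingular u v}

lemma exists_isSeriesAt (h : (curve a b).Nonsingular u v) : ∃ ε, IsSeriesAt h ε := by
  obtain ⟨p, q, p0, q0, hp, hq⟩ := isCentered_expansionAt (.some u v h : (curve a b).Point)
  obtain ⟨h1, h2, h3⟩ := (isExpansion_expansionAt _).affine_equations hp hq
  set ε := coordHom (a := a) (b := b) PowerSeries.C p q h3
  have hx : ε (CoordinateRing.mk _ (C X)) = p := coordHom_x _ _ _ _
  have hy : ε (CoordinateRing.mk _ Y) = q := coordHom_y _ _ _ _
  have hc : ∀ c : ℂ, ε (CoordinateRing.mk _ (C (C c))) = PowerSeries.C c :=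
    coordHom_const _ _ _ _
  refine ⟨ε, ⟨fun f => ?_, fun F => ?_, hc, by rw [hx, hy, h1], by rw [hx, hy, h2]⟩⟩
  · have : (ofPowerSeries ℤ ℂ).comp ε =
        (expansionAt (.some u v h)).comp (algebraMap (curve a b).CoordinateRing _) := by
      refine coordinateRing_hom_ext (fun c => ?_) ?_ ?_
      · rw [RingHom.comp_apply, RingHom.comp_apply, hc, expansionAt_const,
          HahnSeries.ofPowerSeries_C]
      · rw [RingHom.comp_apply, RingHom.comp_apply, hx, ← hp, xFun]
      · rw [RingHom.comp_apply, RingHom.comp_apply, hy, ← hq, yFun]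
    exact RingHom.congr_fun this f
  · have := coordinateRing_hom_apply_mk (PowerSeries.constantCoeff.comp ε)
      (fun c => by rw [RingHom.comp_apply, hc, PowerSeries.constantCoeff_C]) F
    simp only [RingHom.comp_apply] at this
    rw [this, hx, hy, p0, q0]

lemma associated_X_of_derivative {p : PowerSeries ℂ} (h0 : PowerSeries.constantCoeff p = 0)
    (h1 : PowerSeries.constantCoeff (PowerSeries.derivative ℂ p) ≠ 0) :
    Associated p PowerSeries.X := by
  obtain ⟨q, rfl⟩ := PowerSeries.X_dvd_iff.mpr h0
  have hq : IsUnit q := by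
    rw [PowerSeries.isUnit_iff_constantCoeff]
    simpa using h1
  exact associated_mul_unit_left _ _ hq

namespace IsSeriesAt

variable {ε : (curve a b).CoordinateRing →+* PowerSeries ℂ} (hε : IsSeriesAt h ε)
include hε

lemma injective : Function.Injective ε := by
  intro f g hfg
  have := (hε.coe f).symm.trans ((congrArg _ hfg).trans (hε.coe g))
  exact IsFractionRing.injective _ _ ((expansionAt _).injective this)

lemma constantCoeff_x_sub (c : ℂ) :
    PowerSeries.constantCoeff (ε (CoordinateRing.mk _ (C (X - C c)))) = u - c := by
  rw [hε.constantCoeff]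
  simp [evalEval_C]

lemma constantCoeff_y_sub (c : ℂ) :
    PowerSeries.constantCoeff (ε (CoordinateRing.mk _ (Y - C (C c)))) = v - c := by
  rw [hε.constantCoeff]
  simp

lemma constantCoeff_deriv_x_sub (c : ℂ) : PowerSeries.constantCoeff
    (PowerSeries.derivative ℂ (ε (CoordinateRing.mk _ (C (X - C c))))) = 2 * v := by
  rw [C_sub, map_sub, map_sub, map_sub, hε.const, PowerSeries.derivative_C, sub_zero, hε.deriv_x,
    map_mul, hε.constantCoeff, map_ofNat]
  simp

lemma constantCoeff_deriv_y_sub (c : ℂ) : PowerSeries.constantCoeff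
    (PowerSeries.derivative ℂ (ε (CoordinateRing.mk _ (Y - C (C c))))) = 3 * u ^ 2 + a := by
  rw [map_sub, map_sub, map_sub, hε.const, PowerSeries.derivative_C, sub_zero, hε.deriv_y,
    map_add, map_mul, map_pow, hε.constantCoeff, map_ofNat]
  simp [evalEval_C]

/-- This converts factorizations of ideals into orders of vanishing. At the point itself `x - u` or
`y - v` is a uniformizer, since `x' = 2y` and `y' = 3x² + a` do not both vanish there; elsewhere one
generator is a unit. -/
lemma map_pointIdeal (A : (curve a b).Point) :
    (pointIdeal A).map ε = Ideal.span {PowerSeries.X ^ mult (.some u v h) A} := by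
  rcases A with _ | ⟨x, y, hA⟩
  · have : mult (.some u v h) (WeierstrassCurve.Affine.Point.zero : (curve a b).Point) = 0 :=
      if_neg (by rintro ⟨⟩)
    rw [this, pow_zero, Ideal.span_singleton_one, pointIdeal, Ideal.map_top]
  · rw [pointIdeal, CoordinateRing.XYIdeal, CoordinateRing.XClass, CoordinateRing.YClass,
      Ideal.map_span, Set.image_pair]
    have hx := hε.constantCoeff_x_sub x
    have hy := hε.constantCoeff_y_sub y
    by_cases hPA : u = x ∧ v = y
    · obtain ⟨rfl, rfl⟩ := hPA
      have : mult (.some u v h) (.some u v hA : (curve a b).Point) = 1 := if_pos rfl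
      rw [this, pow_one]
      rw [sub_self] at hx hy
      apply le_antisymm
      · rw [Ideal.span_le]
        rintro f (rfl | rfl)
        · exact Ideal.mem_span_singleton.mpr (PowerSeries.X_dvd_iff.mpr hx)
        · exact Ideal.mem_span_singleton.mpr (PowerSeries.X_dvd_iff.mpr hy)
      · rw [Ideal.span_singleton_le_iff_mem]
        rcases (nonsingular_iff.mp h).2 with hv | hu
        · have := associated_X_of_derivative hx
            (by rw [hε.constantCoeff_deriv_x_sub]; exact mul_ne_zero two_ne_zero hv)
          exact Ideal.mem_of_dvd _ this.dvd (Ideal.subset_span (by simp))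
        · have := associated_X_of_derivative hy (by rwa [hε.constantCoeff_deriv_y_sub])
          exact Ideal.mem_of_dvd _ this.dvd (Ideal.subset_span (by simp))
    · have : mult (.some u v h) (.some x y hA : (curve a b).Point) = 0 :=
        if_neg fun h => hPA (by simpa using h)
      rw [this, pow_zero, Ideal.span_singleton_one]
      rcases not_and_or.mp hPA with hu | hv
      · refine Ideal.eq_top_of_isUnit_mem _ (Ideal.subset_span (Set.mem_insert _ _))
          (PowerSeries.isUnit_iff_constantCoeff.mpr ?_)
        rw [hx]
        exact (sub_ne_zero.mpr hu).isUnit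
      · refine Ideal.eq_top_of_isUnit_mem _
          (Ideal.subset_span (Set.mem_insert_of_mem _ (Set.mem_singleton _)))
          (PowerSeries.isUnit_iff_constantCoeff.mpr ?_)
        rw [hy]
        exact (sub_ne_zero.mpr hv).isUnit

lemma order_of_map_span {f : (curve a b).CoordinateRing} {n : ℕ}
    (hf : (Ideal.span {f}).map ε = Ideal.span {PowerSeries.X ^ n}) :
    (expansionAt (.some u v h) (algebraMap _ _ f)).order = n := by
  rw [Ideal.map_span, Set.image_singleton, Ideal.span_singleton_eq_span_singleton] at hf
  rw [← hε.coe, order_ofPowerSeries_of_associated hf]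

lemma mem_XYIdeal {f : (curve a b).CoordinateRing}
    (hf : PowerSeries.constantCoeff (ε f) = 0) :
    ∃ A B : (curve a b).CoordinateRing, f = CoordinateRing.mk _ (C (X - C u)) * A +
      CoordinateRing.mk _ (Y - C (C v)) * B := by
  obtain ⟨F, rfl⟩ := AdjoinRoot.mk_surjective f
  rw [hε.constantCoeff] at hf
  obtain ⟨B, hB⟩ := Polynomial.X_sub_C_dvd_sub_C_eval (a := C v) (p := F)
  obtain ⟨A, hA⟩ := Polynomial.dvd_iff_isRoot.mpr (show (F.eval (C v)).IsRoot u from hf)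
  refine ⟨CoordinateRing.mk _ (C A), CoordinateRing.mk _ B, ?_⟩
  have hF : F = C (X - C u) * C A + (Y - C (C v)) * B := by
    rw [← hB, ← C_mul, ← hA]
    ring
  conv_lhs => rw [hF]
  rw [map_add, map_mul, map_mul]

omit hε in
lemma le_order_ofPowerSeries {p : PowerSeries ℂ} {n : ℕ} (h : PowerSeries.X ^ n ∣ p) (hp : p ≠ 0) :
    (n : ℤ) ≤ (ofPowerSeries ℤ ℂ p).order := by
  obtain ⟨q, rfl⟩ := h
  rw [map_mul, HahnSeries.order_mul
    (ofPowerSeries_ne_zero (pow_ne_zero _ PowerSeries.X_ne_zero))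
    (ofPowerSeries_ne_zero (right_ne_zero_of_mul hp)), order_ofPowerSeries_X_pow]
  have := order_ofPowerSeries_nonneg q
  omega

/-- The strict drop behind the descent in `exists_fraction`. If `v ≠ 0`, then `y + v` is a unit. If
`v = 0`, then `y` is a uniformizer, while `x - u` vanishes doubly because `x' = 2y`. -/
lemma order_y_add_lt : (ofPowerSeries ℤ ℂ (ε (CoordinateRing.mk _ (Y - C (C (-v)))))).order <
    (ofPowerSeries ℤ ℂ (ε (CoordinateRing.mk _ (C (X - C u))))).order := by
  have hx := hε.constantCoeff_x_sub u
  have hy := hε.constantCoeff_y_sub (-v)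
  rw [sub_self] at hx
  have hx0 : ε (CoordinateRing.mk _ (C (X - C u))) ≠ 0 :=
    (map_ne_zero_iff _ hε.injective).mpr (CoordinateRing.XClass_ne_zero u)
  by_cases hv : v = 0
  · have hy1 : (ofPowerSeries ℤ ℂ (ε (CoordinateRing.mk _ (Y - C (C (-v)))))).order = 1 := by
      have := associated_X_of_derivative (by rw [hy, hv]; simp) (by
        rw [hε.constantCoeff_deriv_y_sub]
        exact (nonsingular_iff.mp h).2.resolve_left (by simp [hv]))
      rw [← pow_one PowerSeries.X] at this
      exact order_ofPowerSeries_of_associated this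
    rw [hy1]
    have : PowerSeries.X ^ 2 ∣ ε (CoordinateRing.mk _ (C (X - C u))) := by
      refine X_pow_succ_dvd_of_derivative ?_ hx
      rw [pow_one, PowerSeries.X_dvd_iff, hε.constantCoeff_deriv_x_sub, hv, mul_zero]
    have := le_order_ofPowerSeries this hx0
    push_cast at this
    omega
  · rw [order_ofPowerSeries_unit (PowerSeries.isUnit_iff_constantCoeff.mpr ?_)]
    · exact order_ofPowerSeries_pos hx hx0
    · rw [hy]
      exact IsUnit.mk0 _ (by rw [sub_neg_eq_add, ← two_mul]; exact mul_ne_zero two_ne_zero hv)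

/-- A rational function that is regular at an affine point has a representation as a fraction whose
denominator does not vanish there. -/
theorem exists_fraction {f : (curve a b).FunctionField}
    (hf : 0 ≤ (expansionAt (.some u v h) f).order) :
    ∃ F G : (curve a b).CoordinateRing, PowerSeries.constantCoeff (ε G) ≠ 0 ∧
      f * algebraMap _ _ G = algebraMap _ _ F := by
  obtain ⟨φ, hφ⟩ := exists_ofPowerSeries_of_order_nonneg hf
  -- Descent on the order of the denominator at the point.
  have key : ∀ (n : ℕ) (F G : (curve a b).CoordinateRing), G ≠ 0 →
      f * algebraMap _ _ G = algebraMap _ _ F → (ofPowerSeries ℤ ℂ (ε G)).order < n →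
      ∃ F G : (curve a b).CoordinateRing, PowerSeries.constantCoeff (ε G) ≠ 0 ∧
        f * algebraMap _ _ G = algebraMap _ _ F := by
    intro n
    induction n with
    | zero =>
      intro F G _ _ h0
      have := order_ofPowerSeries_nonneg (ε G)
      push_cast at h0
      omega
    | succ n ih =>
      intro F G hG hFG hn
      by_cases hG0 : PowerSeries.constantCoeff (ε G) = 0
      swap
      · exact ⟨F, G, hG0, hFG⟩
      have hF0 : PowerSeries.constantCoeff (ε F) = 0 := by
        have h1 := congrArg (expansionAt (.some u v h)) hFG
        rw [map_mul, hφ, ← hε.coe, ← hε.coe, ← map_mul, ofPowerSeries_inj] at h1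
        rw [← h1, map_mul, hG0, mul_zero]
      -- On the curve, `(y + v)(y - v) = (x - u)(x² + u x + u² + a)`.
      have hrel : CoordinateRing.mk (curve a b) (Y - C (C (-v))) *
          CoordinateRing.mk (curve a b) (Y - C (C v)) =
          CoordinateRing.mk (curve a b) (C (X - C u)) *
            CoordinateRing.mk (curve a b) (C (X ^ 2 + C u * X + C (u ^ 2 + a))) := by
        rw [← map_mul, ← map_mul]
        refine AdjoinRoot.mk_eq_mk.mpr ⟨1, ?_⟩
        have := (nonsingular_iff.mp h).1
        simp only [curve, WeierstrassCurve.Affine.polynomial, C_0, C_mul, C_add, C_pow, C_sub,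
          C_neg]
        have h2 := congrArg (fun c : ℂ => (C (C c) : ℂ[X][Y])) this
        simp only [C_mul, C_add, C_pow] at h2
        linear_combination -h2
      obtain ⟨A, B, hAB⟩ := hε.mem_XYIdeal hG0
      obtain ⟨A', B', hAB'⟩ := hε.mem_XYIdeal hF0
      set α := CoordinateRing.mk (curve a b) (C (X - C u)) with hα
      set β := CoordinateRing.mk (curve a b) (Y - C (C v))
      set γ := CoordinateRing.mk (curve a b) (Y - C (C (-v)))
      set δ := CoordinateRing.mk (curve a b) (C (X ^ 2 + C u * X + C (u ^ 2 + a)))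
      have hα0 : α ≠ 0 := CoordinateRing.XClass_ne_zero u
      have hγ0 : γ ≠ 0 := by
        have := CoordinateRing.YClass_ne_zero (W' := curve a b) (C (-v))
        rwa [CoordinateRing.YClass] at this
      -- Multiplication by `y + v` makes both generators of the point ideal divisible by `x - u`.
      -- Cancelling `x - u` then lowers the order of the denominator.
      have hG' : γ * G = α * (γ * A + δ * B) := by rw [hAB]; linear_combination B * hrel
      have hF' : γ * F = α * (γ * A' + δ * B') := by rw [hAB']; linear_combination B' * hrel
      have hG'0 : γ * A + δ * B ≠ 0 := right_ne_zero_of_mul (hG' ▸ mul_ne_zero hγ0 hG)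
      refine ih (γ * A' + δ * B') (γ * A + δ * B) hG'0 ?_ ?_
      · have hα0' := (map_ne_zero_iff _
          (IsFractionRing.injective (curve a b).CoordinateRing (curve a b).FunctionField)).mpr hα0
        apply mul_left_cancel₀ hα0'
        rw [← map_mul, ← hF', mul_left_comm, ← map_mul, ← hG', map_mul, map_mul, ← hFG]
        ring
      · have h1 := congrArg (fun f => (ofPowerSeries ℤ ℂ (ε f)).order) hG'
        have hne : ∀ {f}, f ≠ 0 → ofPowerSeries ℤ ℂ (ε f) ≠ 0 := fun hf =>
          ofPowerSeries_ne_zero ((map_ne_zero_iff _ hε.injective).mpr hf)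
        simp only [map_mul ε, map_mul (ofPowerSeries ℤ ℂ)] at h1
        rw [HahnSeries.order_mul (hne hγ0) (hne hG), HahnSeries.order_mul (hne hα0) (hne hG'0)]
          at h1
        have h2 := hε.order_y_add_lt
        push_cast at hn
        change (ofPowerSeries ℤ ℂ (ε γ)).order < (ofPowerSeries ℤ ℂ (ε α)).order at h2
        omega
  obtain ⟨⟨F, G⟩, hFG⟩ := IsLocalization.surj (nonZeroDivisors (curve a b).CoordinateRing) f
  exact key ((ofPowerSeries ℤ ℂ (ε G)).order.toNat + 1) F G (nonZeroDivisors.ne_zero G.2) hFG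
    (by push_cast; omega)

end IsSeriesAt

end AffineOrders

/-! ### Rational functions are determined by their divisors up to constants. -/

section Global

variable {a b : ℂ} [hab : Fact (4 * a ^ 3 + 27 * b ^ 2 ≠ 0)]

omit hab in
-- The Nullstellensatz: the residue field is finite over `ℂ`, hence equal to it.
lemma exists_residue_hom (M : Ideal (curve a b).CoordinateRing) (hM : M.IsMaximal) :
    ∃ χ : (curve a b).CoordinateRing →+* ℂ,
      (∀ c : ℂ, χ (CoordinateRing.mk _ (C (C c))) = c) ∧ ∀ f ∈ M, χ f = 0 := by
  have h1 : Module.Finite ℂ[X] (curve a b).CoordinateRing := .of_basis (CoordinateRing.basis _)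
  have h2 : Algebra.FiniteType ℂ (curve a b).CoordinateRing :=
    Algebra.FiniteType.trans (S := ℂ[X]) inferInstance inferInstance
  let _ := Ideal.Quotient.field M
  have h3 : Algebra.FiniteType ℂ ((curve a b).CoordinateRing ⧸ M) :=
    h2.of_surjective (Ideal.Quotient.mkₐ ℂ M) (Ideal.Quotient.mkₐ_surjective ℂ M)
  have h4 : Module.Finite ℂ ((curve a b).CoordinateRing ⧸ M) :=
    finite_of_finite_type_of_isJacobsonRing _ _
  have h5 : Function.Bijective (algebraMap ℂ ((curve a b).CoordinateRing ⧸ M)) :=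
    IsAlgClosed.algebraMap_bijective_of_isIntegral
  set σ := RingEquiv.ofBijective _ h5
  refine ⟨(σ.symm : _ →+* ℂ).comp (Ideal.Quotient.mk M), fun c => ?_, fun f hf => ?_⟩
  · have : Ideal.Quotient.mk M (CoordinateRing.mk _ (C (C c))) = σ c := rfl
    rw [RingHom.comp_apply, this]
    exact σ.symm_apply_apply c
  · rw [RingHom.comp_apply, Ideal.Quotient.eq_zero_iff_mem.mpr hf, map_zero]

omit hab in
lemma mk_C_ne_zero {p : ℂ[X]} (hp : p ≠ 0) : CoordinateRing.mk (curve a b) (C p) ≠ 0 :=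
  (map_ne_zero_iff (algebraMap ℂ[X] (curve a b).CoordinateRing)
    (FaithfulSMul.algebraMap_injective _ _)).mpr hp

lemma expansionAt_ne_zero (P : (curve a b).Point) {f : (curve a b).FunctionField} (hf : f ≠ 0) :
    expansionAt P f ≠ 0 :=
  (_root_.map_ne_zero _).mpr hf

omit hab in
lemma algebraMap_ne_zero {g : (curve a b).CoordinateRing} (hg : g ≠ 0) :
    algebraMap _ (curve a b).FunctionField g ≠ 0 :=
  (map_ne_zero_iff _ (IsFractionRing.injective _ _)).mpr hg

lemma expansionAt_algebraMap_ne_zero (P : (curve a b).Point) {g : (curve a b).CoordinateRing}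
    (hg : g ≠ 0) : expansionAt P (algebraMap _ _ g) ≠ 0 :=
  expansionAt_ne_zero P (algebraMap_ne_zero hg)

/-- A rational function without poles at affine points is in the coordinate ring. -/
theorem exists_eq_algebraMap {f : (curve a b).FunctionField}
    (hf : ∀ P : (curve a b).Point, P ≠ 0 → 0 ≤ (expansionAt P f).order) :
    ∃ g : (curve a b).CoordinateRing, f = algebraMap _ _ g := by
  -- The ideal of denominators of `f`. If proper, all its elements vanish at some point,
  -- contradicting `exists_fraction` there.
  let I : Ideal (curve a b).CoordinateRing :=
    { carrier := {G | ∃ F : (curve a b).CoordinateRing, f * algebraMap _ _ G = algebraMap _ _ F}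
      add_mem' := by
        rintro G G' ⟨F, hF⟩ ⟨F', hF'⟩
        exact ⟨F + F', by rw [map_add, map_add, mul_add, hF, hF']⟩
      zero_mem' := ⟨0, by rw [map_zero, mul_zero]⟩
      smul_mem' := by
        rintro c G ⟨F, hF⟩
        exact ⟨c * F, by rw [smul_eq_mul, map_mul, map_mul, mul_left_comm, hF]⟩ }
  by_cases hI : I = ⊤
  · obtain ⟨F, hF⟩ : (1 : (curve a b).CoordinateRing) ∈ I := hI ▸ Submodule.mem_top
    exact ⟨F, by rw [← hF, map_one, mul_one]⟩
  · exfalso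
    obtain ⟨M, hM, hIM⟩ := Ideal.exists_le_maximal I hI
    obtain ⟨χ, hχ, hχM⟩ := exists_residue_hom M hM
    have heq := congrArg χ (coordinateRing_equation (a := a) (b := b))
    simp only [map_pow, map_add, map_mul, hχ] at heq
    have hns := nonsingular_of_equation heq
    obtain ⟨ε, hε⟩ := exists_isSeriesAt hns
    obtain ⟨F, G, hG, hFG⟩ := hε.exists_fraction
      (hf (.some _ _ hns) (WeierstrassCurve.Affine.Point.some_ne_zero hns))
    obtain ⟨g, rfl⟩ := AdjoinRoot.mk_surjective G
    refine hG ?_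
    rw [hε.constantCoeff, ← coordinateRing_hom_apply_mk χ hχ]
    exact hχM _ (hIM ⟨F, hFG⟩)

lemma order_infinity_polynomial (p : ℂ[X]) (hp : p ≠ 0) :
    (expansionAt (0 : (curve a b).Point) (algebraMap _ _
      (CoordinateRing.mk (curve a b) (C p)))).order = -2 * p.natDegree := by
  induction hn : p.natDegree generalizing p with
  | zero =>
    rw [natDegree_eq_zero] at hn
    obtain ⟨c, rfl⟩ := hn
    rw [expansionAt_const, HahnSeries.order_C]
    simp
  | succ n ih =>
    obtain ⟨r, hr⟩ := IsAlgClosed.exists_root p (by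
      rw [degree_eq_natDegree hp, hn]
      exact_mod_cast n.succ_ne_zero)
    obtain ⟨q, rfl⟩ := Polynomial.dvd_iff_isRoot.mpr hr
    have hq : q ≠ 0 := right_ne_zero_of_mul hp
    have hx : (X - C r : ℂ[X]) ≠ 0 := X_sub_C_ne_zero r
    have hne : ∀ {s : ℂ[X]}, s ≠ 0 → expansionAt (0 : (curve a b).Point) (algebraMap _ _
        (CoordinateRing.mk (curve a b) (C s))) ≠ 0 :=
        fun hs => expansionAt_algebraMap_ne_zero _ (mk_C_ne_zero hs)
    rw [natDegree_mul hx hq, natDegree_X_sub_C] at hn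
    rw [C_mul, map_mul, map_mul, map_mul, HahnSeries.order_mul (hne hx) (hne hq),
      (infinity_x_sub r).1, ih q hq (by omega)]
    push_cast
    ring

lemma order_infinity_y : (expansionAt (0 : (curve a b).Point) (yFun _)).order = -3 := by
  obtain ⟨p, q, -, hy⟩ := expansionAt_zero_spec (a := a) (b := b)
  refine (order_and_logCoeff_of_mul_eq (p := 1 + PowerSeries.X ^ 4 * q) (q := -1) (n := 3) (by simp)
    ?_ (by simp) (hy.trans ?_)).1
  · simp [PowerSeries.coeff_X_pow_mul', PowerSeries.coeff_one]
  · rw [map_neg, map_one]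

/-- A regular function on the affine curve that has no pole at infinity is constant. -/
theorem eq_const_of_order_infinity_nonneg {g : (curve a b).CoordinateRing}
    (hg : 0 ≤ (expansionAt (0 : (curve a b).Point) (algebraMap _ _ g)).order) :
    ∃ c : ℂ, g = CoordinateRing.mk _ (C (C c)) := by
  obtain ⟨p, q, rfl⟩ := CoordinateRing.exists_smul_basis_eq g
  rw [CoordinateRing.smul, CoordinateRing.smul, mul_one] at hg ⊢
  obtain ⟨φ, hφ⟩ := exists_ofPowerSeries_of_order_nonneg hg
  have hcoeff : ∀ m < 0, (expansionAt (0 : (curve a b).Point) (algebraMap _ _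
      (CoordinateRing.mk (curve a b) (C p)))).coeff m +
      (expansionAt (0 : (curve a b).Point) (algebraMap _ _
        (CoordinateRing.mk (curve a b) (C q) * CoordinateRing.mk (curve a b) Y))).coeff m = 0 := by
    intro m hm
    rw [← HahnSeries.coeff_add, ← map_add, ← map_add, hφ, PowerSeries.coeff_coe, if_pos hm]
  have hy0 : expansionAt (0 : (curve a b).Point) (yFun _) ≠ 0 := expansionAt_ne_zero _ yFun_ne_zero
  by_cases hq : q = 0
  · by_cases hp : p = 0
    · exact ⟨0, by simp [hq, hp]⟩
    · have hdeg := order_infinity_polynomial (a := a) (b := b) p hp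
      rw [hq, C_0, map_zero, zero_mul, add_zero] at hg
      rw [hdeg] at hg
      obtain ⟨c, rfl⟩ := natDegree_eq_zero.mp (by omega : p.natDegree = 0)
      exact ⟨c, by simp [hq]⟩
  · exfalso
    have hq0 : expansionAt (0 : (curve a b).Point) (algebraMap _ _
        (CoordinateRing.mk (curve a b) (C q))) ≠ 0 :=
        expansionAt_algebraMap_ne_zero _ (mk_C_ne_zero hq)
    have hqo := order_infinity_polynomial (a := a) (b := b) q hq
    have hqy : (expansionAt (0 : (curve a b).Point) (algebraMap _ _
        (CoordinateRing.mk (curve a b) (C q) * CoordinateRing.mk (curve a b) Y))).order =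
          -2 * q.natDegree - 3 := by
      rw [map_mul, map_mul]
      change (_ * expansionAt 0 (yFun _)).order = _
      rw [HahnSeries.order_mul hq0 hy0, hqo, order_infinity_y]
      ring
    have hqy0 : expansionAt (0 : (curve a b).Point) (algebraMap _ _
        (CoordinateRing.mk (curve a b) (C q) * CoordinateRing.mk (curve a b) Y)) ≠ 0 := by
      rw [map_mul, map_mul]
      exact mul_ne_zero hq0 hy0
    by_cases hp : p = 0
    · have := hcoeff _ (by omega : (-2 * q.natDegree - 3 : ℤ) < 0)
      rw [hp, C_0, map_zero, map_zero, map_zero, HahnSeries.coeff_zero, zero_add, ← hqy] at this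
      exact HahnSeries.coeff_order_eq_zero.not.mpr hqy0 this
    · have hp0 : expansionAt (0 : (curve a b).Point) (algebraMap _ _
          (CoordinateRing.mk (curve a b) (C p))) ≠ 0 :=
        expansionAt_algebraMap_ne_zero _ (mk_C_ne_zero hp)
      have hpo := order_infinity_polynomial (a := a) (b := b) p hp
      -- The two orders have different parity, so the leading terms of `p` and `q y` cannot cancel,
      -- and a pole remains.
      rcases lt_or_gt_of_ne (by omega :
          (-2 * p.natDegree : ℤ) ≠ -2 * q.natDegree - 3) with hlt | hlt
      · have := hcoeff _ (by omega : (-2 * p.natDegree : ℤ) < 0)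
        rw [HahnSeries.coeff_eq_zero_of_lt_order (hlt.trans_eq hqy.symm), add_zero, ← hpo] at this
        exact HahnSeries.coeff_order_eq_zero.not.mpr hp0 this
      · have := hcoeff _ (by omega : (-2 * q.natDegree - 3 : ℤ) < 0)
        rw [HahnSeries.coeff_eq_zero_of_lt_order (hlt.trans_eq hpo.symm), zero_add, ← hqy] at this
        exact HahnSeries.coeff_order_eq_zero.not.mpr hqy0 this

/-- A rational function without zeros and poles at affine points is constant. -/
theorem eq_const_of_order_eq_zero {f : (curve a b).FunctionField} (hf0 : f ≠ 0)
    (hf : ∀ P : (curve a b).Point, P ≠ 0 → (expansionAt P f).order = 0) :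
    ∃ c : ℂ, c ≠ 0 ∧ f = algebraMap _ _ (CoordinateRing.mk (curve a b) (C (C c))) := by
  have hinv : ∀ P : (curve a b).Point,
      (expansionAt P f).order + (expansionAt P f⁻¹).order = 0 := by
    intro P
    rw [← HahnSeries.order_mul (expansionAt_ne_zero _ hf0) (expansionAt_ne_zero _ (inv_ne_zero hf0)),
      ← map_mul, mul_inv_cancel₀ hf0, map_one, HahnSeries.order_one]
  -- One of `f` and `f⁻¹` has no pole at infinity either, hence is constant.
  rcases le_total 0 (expansionAt (0 : (curve a b).Point) f).order with h | h
  · obtain ⟨g, rfl⟩ := exists_eq_algebraMap fun P hP => (hf P hP).ge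
    obtain ⟨c, rfl⟩ := eq_const_of_order_infinity_nonneg h
    refine ⟨c, ?_, rfl⟩
    rintro rfl
    simp at hf0
  · obtain ⟨g, hg⟩ := exists_eq_algebraMap (f := f⁻¹) fun P hP => by
      have := hinv P
      rw [hf P hP] at this
      omega
    obtain ⟨c, rfl⟩ := eq_const_of_order_infinity_nonneg (g := g) (by
      rw [← hg]
      have := hinv 0
      omega)
    have hc : c ≠ 0 := by
      rintro rfl
      exact inv_ne_zero hf0 (by rw [hg]; simp)
    refine ⟨c⁻¹, inv_ne_zero hc, ?_⟩
    have h1 : f * algebraMap _ _ (CoordinateRing.mk (curve a b) (C (C c))) = 1 := by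
      rw [← hg, mul_inv_cancel₀ hf0]
    have h2 : algebraMap _ (curve a b).FunctionField (CoordinateRing.mk (curve a b) (C (C c))) *
        algebraMap _ _ (CoordinateRing.mk (curve a b) (C (C c⁻¹))) = 1 := by
      rw [← map_mul, ← map_mul, ← C_mul, ← C_mul, mul_inv_cancel₀ hc]
      simp
    linear_combination
      algebraMap _ _ (CoordinateRing.mk (curve a b) (C (C c⁻¹))) * h1 - f * h2

lemma eq_const_of_isUnit {f : (curve a b).CoordinateRing} (hf : IsUnit f) :
    ∃ c : ℂ, c ≠ 0 ∧ f = CoordinateRing.mk _ (C (C c)) := by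
  obtain ⟨c, hc, h⟩ := eq_const_of_order_eq_zero (f := algebraMap _ _ f)
    (algebraMap_ne_zero hf.ne_zero) (by
      rintro (_ | ⟨u, v, hP⟩) h0
      · exact absurd rfl h0
      · obtain ⟨ε, hε⟩ := exists_isSeriesAt hP
        rw [← hε.coe, order_ofPowerSeries_unit (hf.map ε)])
  exact ⟨c, hc, IsFractionRing.injective _ _ h⟩

/-- Functions in the coordinate ring with the same divisor have the same logarithmic derivative. -/
lemma logCoeff_eq_of_span_eq {f g : (curve a b).CoordinateRing} (hf : f ≠ 0)
    (h : Ideal.span {f} = Ideal.span {g}) (P : (curve a b).Point) :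
    logCoeff (expansionAt P (algebraMap _ _ f)) = logCoeff (expansionAt P (algebraMap _ _ g)) := by
  obtain ⟨u, rfl⟩ := Ideal.span_singleton_eq_span_singleton.mp h
  obtain ⟨c, hc, hu⟩ := eq_const_of_isUnit u.isUnit
  rw [map_mul, map_mul, logCoeff_mul (expansionAt_algebraMap_ne_zero P hf)
    (expansionAt_algebraMap_ne_zero P u.ne_zero), hu, expansionAt_const, logCoeff_C,
    add_zero]

end Global

/-! ### Lines through three points, and principal powers of point ideals. -/

section Lines

variable {a b : ℂ}

lemma pointIdeal_mul_neg {A : (curve a b).Point} (hA : A ≠ 0) :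
    pointIdeal A * pointIdeal (-A) =
      Ideal.span {CoordinateRing.mk _ (C (X - C (xCoord A)))} := by
  rcases A with _ | ⟨x, y, h⟩
  · exact absurd rfl hA
  · rw [WeierstrassCurve.Affine.Point.neg_some, mul_comm]
    exact CoordinateRing.XYIdeal_neg_mul h

/-- For cancelling the vertical line `x = x(p + q)` from the ideal identity of the addition law:
multiply by `J`, then cancel `x`. -/
lemma eq_mul_of_mul_eq {R : Type*} [CommRing R] [IsDomain R] {I₁ I₂ I₃ J L : Ideal R} {x : R}
    (hx : x ≠ 0) (h : Ideal.span {x} * (I₁ * I₂) = L * I₃) (h' : I₃ * J = Ideal.span {x}) :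
    L = I₁ * I₂ * J := by
  rw [← Ideal.span_singleton_mul_right_inj hx, ← mul_assoc, h, mul_assoc, h', mul_comm]

/-- The line through three affine points with sum `0`. -/
lemma exists_cutsOut {p q r : (curve a b).Point} (hp : p ≠ 0) (hq : q ≠ 0) (hr : r ≠ 0)
    (h : p + q + r = 0) :
    ∃ s t : ℂ, CutsOut s t p q r ∧ xCoord p + xCoord q + xCoord r = s ^ 2 := by
  classical
  obtain rfl : r = -(p + q) := (neg_eq_of_add_eq_zero_right h).symm
  rcases p with _ | ⟨x₁, y₁, h₁⟩
  · exact absurd rfl hp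
  rcases q with _ | ⟨x₂, y₂, h₂⟩
  · exact absurd rfl hq
  -- The chord or tangent is vertical only if `q = -p`, which would give `r = 0`.
  have hxy : ¬(x₁ = x₂ ∧ y₁ = (curve a b).negY x₂ y₂) := by
    rintro ⟨rfl, rfl⟩
    refine hr ?_
    rw [WeierstrassCurve.Affine.Point.add_of_Y_eq rfl rfl, neg_zero]
  set ℓ := (curve a b).slope x₁ x₂ y₁ y₂ with hℓ
  have hsum := WeierstrassCurve.Affine.Point.add_some hxy (h₁ := h₁) (h₂ := h₂)
  have h1 := CoordinateRing.XYIdeal_mul_XYIdeal h₁.1 h₂.1 hxy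
  have h2 := pointIdeal_mul_neg (a := a) (b := b) (neg_ne_zero.mp hr)
  rw [hsum] at h2
  refine ⟨-ℓ, ℓ * x₁ - y₁, ?_, ?_⟩
  · rw [hsum, CutsOut]
    rw [CoordinateRing.XIdeal, CoordinateRing.YIdeal] at h1
    have hX : CoordinateRing.XClass (curve a b) ((curve a b).addX x₁ x₂ ℓ) ≠ 0 :=
      CoordinateRing.XClass_ne_zero _
    have hline : CoordinateRing.mk (curve a b) (Y + C (C (-ℓ) * X + C (ℓ * x₁ - y₁))) =
        CoordinateRing.YClass (curve a b) (WeierstrassCurve.Affine.linePolynomial x₁ y₁ ℓ) := by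
      rw [CoordinateRing.YClass, WeierstrassCurve.Affine.linePolynomial]
      congr 1
      simp only [C_neg, C_mul, C_sub, C_add]
      ring
    rw [hline]
    exact eq_mul_of_mul_eq hX h1 h2
  · rw [hsum, WeierstrassCurve.Affine.Point.neg_some]
    simp only [hℓ, xCoord, WeierstrassCurve.Affine.addX, curve]
    ring

variable [hab : Fact (4 * a ^ 3 + 27 * b ^ 2 ≠ 0)]

omit hab in
lemma line_eq (s t : ℂ) : CoordinateRing.mk (curve a b) (Y + C (C s * X + C t)) =
    (C s * X + C t : ℂ[X]) • 1 + (1 : ℂ[X]) • CoordinateRing.mk (curve a b) Y := by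
  rw [CoordinateRing.smul, CoordinateRing.smul, map_add, C_1, map_one]
  ring

omit hab in
lemma line_ne_zero (s t : ℂ) : CoordinateRing.mk (curve a b) (Y + C (C s * X + C t)) ≠ 0 := by
  rw [line_eq]
  intro h
  exact one_ne_zero (CoordinateRing.smul_basis_eq_zero h).2

include hab in
-- The two generators differ by a unit, hence by a constant, which is `1` by the coefficient of `y`
-- in the basis `1, y`.
lemma line_unique {s t s' t' : ℂ}
    (h : Ideal.span {CoordinateRing.mk (curve a b) (Y + C (C s * X + C t))} =
      Ideal.span {CoordinateRing.mk (curve a b) (Y + C (C s' * X + C t'))}) :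
    s = s' ∧ t = t' := by
  obtain ⟨u, hu⟩ := Ideal.span_singleton_eq_span_singleton.mp h
  obtain ⟨c, hc, huc⟩ := eq_const_of_isUnit u.isUnit
  rw [huc, line_eq, line_eq] at hu
  have h1 : (C s * X + C t - C s' * X - C t' + (C c - 1) * (C s * X + C t) : ℂ[X]) •
      (1 : (curve a b).CoordinateRing) +
        (C c - 1 : ℂ[X]) • CoordinateRing.mk (curve a b) Y = 0 := by
    simp only [CoordinateRing.smul, map_add, map_sub, map_mul, map_one]
      at hu ⊢
    linear_combination hu
  obtain ⟨h2, h3⟩ := CoordinateRing.smul_basis_eq_zero h1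
  rw [h3, zero_mul, add_zero] at h2
  have e0 := congrArg (fun p : ℂ[X] => p.coeff 0) h2
  have e1 := congrArg (fun p : ℂ[X] => p.coeff 1) h2
  simp [coeff_C] at e0 e1
  exact ⟨sub_eq_zero.mp e1, sub_eq_zero.mp e0⟩

omit hab in
/-- A power of the ideal of a torsion point is principal. -/
lemma exists_generator {A : (curve a b).Point} {n : ℕ} (hA : n • A = 0) :
    ∃ g : (curve a b).CoordinateRing, g ≠ 0 ∧ Ideal.span {g} = pointIdeal A ^ n := by
  classical
  rcases A with _ | ⟨x, y, h⟩
  · refine ⟨1, one_ne_zero, ?_⟩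
    rw [pointIdeal, Ideal.span_singleton_one, ← Ideal.one_eq_top, one_pow]
  · have h1 := congrArg WeierstrassCurve.Affine.Point.toClass hA
    -- The map from points to ideal classes is additive, so `n • A = 0` makes the class of the
    -- `n`-th power trivial.
    rw [map_nsmul, map_zero, WeierstrassCurve.Affine.Point.toClass_some] at h1
    have h2 : ClassGroup.mk (curve a b).FunctionField
        (CoordinateRing.XYIdeal' (W := curve a b) h ^ n) = 1 := by
      rw [map_pow]
      exact h1
    obtain ⟨g, hg, hg'⟩ := (ClassGroup.mk_eq_one_of_coe_ideal (I' := pointIdeal (.some x y h) ^ n)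
      (by rw [Units.val_pow_eq_pow_val, CoordinateRing.XYIdeal'_eq, FractionalIdeal.coeIdeal_pow,
        pointIdeal])).mp h2
    exact ⟨g, hg, hg'.symm⟩

end Lines

/-! ### Existence and uniqueness of the slope function. -/

section SlopeFunction

variable {a b : ℂ}

lemma IsSlopeFunction.unique {Z : AddSubgroup (curve a b).Point} [Finite Z]
    {z z' : Punctured Z → ℂ} (hz : IsSlopeFunction Z z) (hz' : IsSlopeFunction Z z') : z = z' := by
  classical
  -- The difference, extended by `0` at the origin, is additive; finiteness of `Z` then kills it, as
  -- `ℂ` is torsion-free.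
  let d : Z → ℂ := fun p => if hp : (p : (curve a b).Point) ≠ 0 then
    z ⟨p, p.2, hp⟩ - z' ⟨p, p.2, hp⟩ else 0
  have d0 : d 0 = 0 := dif_neg (by simp)
  have d1 : ∀ (p : Z) (hp : (p : (curve a b).Point) ≠ 0),
      d p = z ⟨p, p.2, hp⟩ - z' ⟨p, p.2, hp⟩ := fun p hp => dif_pos hp
  have dneg : ∀ p : Z, d (-p) = - d p := by
    intro p
    by_cases hp : (p : (curve a b).Point) = 0
    · obtain rfl : p = 0 := Subtype.ext hp
      rw [neg_zero, d0, neg_zero]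
    · have hp' : ((-p : Z) : (curve a b).Point) ≠ 0 := by simpa using hp
      rw [d1 p hp, d1 _ hp']
      have e1 := hz.odd ⟨p, p.2, hp⟩ ⟨_, (-p).2, hp'⟩ rfl
      have e2 := hz'.odd ⟨p, p.2, hp⟩ ⟨_, (-p).2, hp'⟩ rfl
      linear_combination e1 - e2
  have dadd : ∀ p q : Z, d (p + q) = d p + d q := by
    intro p q
    by_cases hp : (p : (curve a b).Point) = 0
    · obtain rfl : p = 0 := Subtype.ext hp
      rw [zero_add, d0, zero_add]
    by_cases hq : (q : (curve a b).Point) = 0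
    · obtain rfl : q = 0 := Subtype.ext hq
      rw [add_zero, d0, add_zero]
    by_cases hpq : ((p + q : Z) : (curve a b).Point) = 0
    · have : p + q = 0 := Subtype.ext hpq
      rw [this, d0, ← neg_eq_of_add_eq_zero_right this, dneg, add_neg_cancel]
    · have hr : ((-(p + q) : Z) : (curve a b).Point) ≠ 0 := by rwa [AddSubgroup.coe_neg, neg_ne_zero]
      have hsum : (p : (curve a b).Point) + q + (-(p + q) : Z) = 0 := by simp
      obtain ⟨s, t, hst, -⟩ := exists_cutsOut hp hq hr hsum
      have e1 := hz.sum_eq ⟨p, p.2, hp⟩ ⟨q, q.2, hq⟩ ⟨_, (-(p + q)).2, hr⟩ hsum s t hst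
      have e2 := hz'.sum_eq ⟨p, p.2, hp⟩ ⟨q, q.2, hq⟩ ⟨_, (-(p + q)).2, hr⟩ hsum s t hst
      have e3 := dneg (p + q)
      rw [d1 _ hr] at e3
      rw [d1 p hp, d1 q hq]
      linear_combination e2 - e1 + e3
  let D : Z →+ ℂ := ⟨⟨d, d0⟩, dadd⟩
  funext ⟨p, hpZ, hp⟩
  have h1 : Nat.card Z • D ⟨p, hpZ⟩ = 0 := by
    rw [← map_nsmul, card_nsmul_eq_zero', map_zero]
  have h2 : D ⟨p, hpZ⟩ = 0 := (smul_eq_zero.mp h1).resolve_left Nat.card_pos.ne'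
  have h3 := d1 ⟨p, hpZ⟩ hp
  exact sub_eq_zero.mp (h3.symm.trans h2)

variable [hab : Fact (4 * a ^ 3 + 27 * b ^ 2 ≠ 0)]

/-- A generator of the `n`-th power of the ideal of a point whose order divides `n`. -/
noncomputable def generator (n : ℕ) (A : (curve a b).Point) : (curve a b).CoordinateRing :=
  open Classical in if h : n • A = 0 then (exists_generator h).choose else 1

omit hab in
lemma generator_ne_zero (n : ℕ) (A : (curve a b).Point) : generator n A ≠ 0 := by
  rw [generator]
  split_ifs with h
  · exact (exists_generator h).choose_spec.1
  · exact one_ne_zero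

omit hab in
lemma span_generator {n : ℕ} {A : (curve a b).Point} (h : n • A = 0) :
    Ideal.span {generator n A} = pointIdeal A ^ n := by
  rw [generator, dif_pos h]
  exact (exists_generator h).choose_spec.2

/-- The constant coefficient of the logarithmic derivative of the generator at infinity. -/
noncomputable def generatorSlope (n : ℕ) (A : (curve a b).Point) : ℂ :=
  logCoeff (expansionAt (0 : (curve a b).Point) (algebraMap _ _ (generator n A)))

lemma generatorSlope_add_neg {n : ℕ} {A : (curve a b).Point} (hA : A ≠ 0) (h : n • A = 0) :
    generatorSlope n A + generatorSlope n (-A) = 0 := by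
  have h' : n • (-A) = 0 := by rw [neg_nsmul, h, neg_zero]
  have hx : CoordinateRing.mk (curve a b) (C (X - C (xCoord A))) ≠ 0 :=
    mk_C_ne_zero (X_sub_C_ne_zero _)
  have h1 : Ideal.span {generator n A * generator n (-A)} =
      Ideal.span {CoordinateRing.mk (curve a b) (C (X - C (xCoord A))) ^ n} := by
    rw [← Ideal.span_singleton_mul_span_singleton, span_generator h, span_generator h',
      ← Ideal.span_singleton_pow, ← pointIdeal_mul_neg hA, mul_pow]
  have h2 := logCoeff_eq_of_span_eq
    (mul_ne_zero (generator_ne_zero n A) (generator_ne_zero n (-A))) h1 0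
  rwa [map_mul, map_mul, logCoeff_mul (expansionAt_algebraMap_ne_zero _ (generator_ne_zero n A))
    (expansionAt_algebraMap_ne_zero _ (generator_ne_zero n (-A))), map_pow, map_pow,
    logCoeff_pow (expansionAt_algebraMap_ne_zero _ hx), (infinity_x_sub _).2, mul_zero] at h2

/-- The three generators multiply to the `n`-th power of the line up to a constant, and the line
contributes `-s` at infinity. -/
lemma generatorSlope_add_add {n : ℕ} {p q r : (curve a b).Point} (hp : n • p = 0) (hq : n • q = 0)
    (hr : n • r = 0) {s t : ℂ} (h : CutsOut s t p q r) :
    generatorSlope n p + generatorSlope n q + generatorSlope n r = -(n * s) := by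
  have h1 : Ideal.span {generator n p * generator n q * generator n r} =
      Ideal.span {CoordinateRing.mk (curve a b) (Y + C (C s * X + C t)) ^ n} := by
    rw [← Ideal.span_singleton_mul_span_singleton, ← Ideal.span_singleton_mul_span_singleton,
      span_generator hp, span_generator hq, span_generator hr,
      ← Ideal.span_singleton_pow, h, mul_pow, mul_pow]
  have hpq := mul_ne_zero (generator_ne_zero n p) (generator_ne_zero n q)
  have h2 := logCoeff_eq_of_span_eq (mul_ne_zero hpq (generator_ne_zero n r)) h1 0
  rw [map_mul, map_mul, logCoeff_mul (expansionAt_algebraMap_ne_zero _ hpq)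
    (expansionAt_algebraMap_ne_zero _ (generator_ne_zero n r)), map_mul, map_mul,
    logCoeff_mul (expansionAt_algebraMap_ne_zero _ (generator_ne_zero n p))
    (expansionAt_algebraMap_ne_zero _ (generator_ne_zero n q)), map_pow, map_pow,
    logCoeff_pow (expansionAt_algebraMap_ne_zero _ (line_ne_zero s t)), (infinity_line s t).2] at h2
  rw [generatorSlope, generatorSlope, generatorSlope, h2]
  ring

omit hab in
lemma card_nsmul_eq_zero_of_mem (Z : AddSubgroup (curve a b).Point)
    {p : (curve a b).Point} (hp : p ∈ Z) : Nat.card Z • p = 0 := by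
  have : Nat.card Z • (⟨p, hp⟩ : Z) = 0 := card_nsmul_eq_zero'
  simpa only [AddSubgroup.coe_nsmul, AddSubgroup.coe_zero] using congrArg Subtype.val this

theorem isSlopeFunction_generatorSlope (Z : AddSubgroup (curve a b).Point) [Finite Z] :
    IsSlopeFunction Z fun p => -generatorSlope (Nat.card Z) (p : (curve a b).Point) / Nat.card Z where
  odd p q hpq := by
    have := generatorSlope_add_neg p.2.2 (card_nsmul_eq_zero_of_mem Z p.2.1)
    rw [hpq, ← add_div]
    rw [div_eq_zero_iff]
    left
    linear_combination -this
  sum_eq p q r _ s t hst := by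
    have := generatorSlope_add_add (card_nsmul_eq_zero_of_mem Z p.2.1)
      (card_nsmul_eq_zero_of_mem Z q.2.1) (card_nsmul_eq_zero_of_mem Z r.2.1) hst
    have hn : (Nat.card Z : ℂ) ≠ 0 := Nat.cast_ne_zero.mpr Nat.card_pos.ne'
    field_simp
    linear_combination -this

end SlopeFunction

/-! ### Orders at affine points of the functions in use. -/

section Orders

variable {a b : ℂ} [hab : Fact (4 * a ^ 3 + 27 * b ^ 2 ≠ 0)]

/-- The rational function `x - x(A)`. -/
noncomputable def xSub (A : (curve a b).Point) : (curve a b).FunctionField :=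
  algebraMap _ _ (CoordinateRing.mk (curve a b) (C (X - C (xCoord A))))

/-- The rational function `y + s x + t`. -/
noncomputable def line (a b s t : ℂ) : (curve a b).FunctionField :=
  algebraMap _ _ (CoordinateRing.mk (curve a b) (Y + C (C s * X + C t)))

omit hab in
lemma xSub_ne_zero (A : (curve a b).Point) : xSub A ≠ 0 :=
  algebraMap_ne_zero (mk_C_ne_zero (X_sub_C_ne_zero _))

omit hab in
lemma lineFun_ne_zero (s t : ℂ) : line a b s t ≠ 0 :=
  algebraMap_ne_zero (line_ne_zero s t)

lemma order_xSub {P : (curve a b).Point} (hP : P ≠ 0) {A : (curve a b).Point} (hA : A ≠ 0) :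
    (expansionAt P (xSub A)).order = mult P A + mult P (-A) := by
  rcases P with _ | ⟨u, v, h⟩
  · exact absurd rfl hP
  obtain ⟨ε, hε⟩ := exists_isSeriesAt h
  rw [xSub, hε.order_of_map_span (n := mult (.some u v h) A + mult (.some u v h) (-A))]
  · push_cast; rfl
  · rw [← pointIdeal_mul_neg hA, Ideal.map_mul, hε.map_pointIdeal, hε.map_pointIdeal,
      Ideal.span_singleton_mul_span_singleton, pow_add]

lemma order_line {P : (curve a b).Point} (hP : P ≠ 0) {p q r : (curve a b).Point} {s t : ℂ}
    (hst : CutsOut s t p q r) :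
    (expansionAt P (line a b s t)).order = mult P p + mult P q + mult P r := by
  rcases P with _ | ⟨u, v, h⟩
  · exact absurd rfl hP
  obtain ⟨ε, hε⟩ := exists_isSeriesAt h
  rw [line, hε.order_of_map_span
    (n := mult (.some u v h) p + mult (.some u v h) q + mult (.some u v h) r)]
  · push_cast; rfl
  · rw [hst, Ideal.map_mul, Ideal.map_mul, hε.map_pointIdeal, hε.map_pointIdeal, hε.map_pointIdeal,
      Ideal.span_singleton_mul_span_singleton, Ideal.span_singleton_mul_span_singleton, pow_add,
      pow_add]

lemma order_generator {P : (curve a b).Point} (hP : P ≠ 0) {A : (curve a b).Point} {n : ℕ}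
    (hA : n • A = 0) :
    (expansionAt P (algebraMap _ _ (generator n A))).order = n * mult P A := by
  rcases P with _ | ⟨u, v, h⟩
  · exact absurd rfl hP
  obtain ⟨ε, hε⟩ := exists_isSeriesAt h
  rw [hε.order_of_map_span (n := mult (.some u v h) A * n)]
  · push_cast; ring
  · rw [span_generator hA, Ideal.map_pow, hε.map_pointIdeal, Ideal.span_singleton_pow, pow_mul]

/-- Two rational functions with the same zeros and poles at affine points have the same order and
logarithmic derivative at infinity. -/
lemma infinity_eq_of_order_eq {f g : (curve a b).FunctionField} (hf : f ≠ 0) (hg : g ≠ 0)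
    (h : ∀ P : (curve a b).Point, P ≠ 0 → (expansionAt P f).order = (expansionAt P g).order) :
    (expansionAt (0 : (curve a b).Point) f).order = (expansionAt (0 : (curve a b).Point) g).order ∧
      logCoeff (expansionAt (0 : (curve a b).Point) f) =
        logCoeff (expansionAt (0 : (curve a b).Point) g) := by
  have hfg : f = f / g * g := (div_mul_cancel₀ f hg).symm
  have hq : f / g ≠ 0 := div_ne_zero hf hg
  obtain ⟨c, hc, hc'⟩ := eq_const_of_order_eq_zero hq fun P hP => by
    have h1 := h P hP
    rw [hfg, map_mul, HahnSeries.order_mul (expansionAt_ne_zero P hq) (expansionAt_ne_zero P hg)]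
      at h1
    omega
  have hC : (HahnSeries.C c : ℂ⸨X⸩) ≠ 0 := (_root_.map_ne_zero _).mpr hc
  have hg0 := expansionAt_ne_zero (0 : (curve a b).Point) hg
  rw [hfg, hc', map_mul, expansionAt_const]
  exact ⟨by rw [HahnSeries.order_mul hC hg0, HahnSeries.order_C, zero_add],
    by rw [logCoeff_mul hC hg0, logCoeff_C, zero_add]⟩

omit hab in
lemma sum_mult (s : Finset (curve a b).Point) (P : (curve a b).Point) [Decidable (P ∈ s)] :
    ∑ S ∈ s, mult P S = if P ∈ s then 1 else 0 := by
  classical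
  simp only [mult]
  rw [Finset.sum_ite_eq]
  split_ifs <;> rfl

omit hab in
lemma mult_neg (P A : (curve a b).Point) : mult P (-A) = mult (-P) A := by
  simp only [mult]
  congr 1
  rw [eq_neg_iff_add_eq_zero, neg_eq_iff_add_eq_zero]

omit hab in
lemma finite_xCoord_fiber (u : ℂ) : {P : (curve a b).Point | P ≠ 0 ∧ xCoord P = u}.Finite := by
  by_cases h : ∃ P : (curve a b).Point, P ≠ 0 ∧ xCoord P = u
  · obtain ⟨P, hP, rfl⟩ := h
    refine (Set.toFinite {P, -P}).subset ?_
    rintro Q ⟨hQ, hQP⟩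
    rcases P with _ | ⟨x, y, hxy⟩
    · exact absurd rfl hP
    rcases Q with _ | ⟨x', y', hxy'⟩
    · exact absurd rfl hQ
    exact WeierstrassCurve.Affine.Point.X_eq_iff.mp hQP
  · refine Set.finite_empty.subset fun P hP => h ⟨P, hP⟩

include hab in
lemma infinite_point : Infinite (curve a b).Point := by
  have h : ∀ u : ℂ, ∃ P : (curve a b).Point, xCoord P = u := fun u => by
    obtain ⟨v, hv⟩ := IsAlgClosed.exists_pow_nat_eq (u ^ 3 + a * u + b) two_pos
    exact ⟨.some u v (nonsingular_of_equation hv), rfl⟩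
  exact Infinite.of_surjective (xCoord (W := curve a b)) h

end Orders

/-- Composed with `e`, the derivation `D` becomes a `k`-derivation of `K` into `L`, so it factors
through the Kähler differentials and can be applied to an identity there. -/
lemma kaehler_eq_imp {k K L : Type*} [Field k] [Field K] [Algebra k K] [Field L] (e : K →+* L)
    (D : L →+ L) (hD : ∀ f g, D (f * g) = f * D g + g * D f)
    (hc : ∀ c : k, D (e (algebraMap k K c)) = 0) {f g f' g' : K}
    (h : f • KaehlerDifferential.D k K g = f' • KaehlerDifferential.D k K g') :
    e f * D (e g) = e f' * D (e g') := by
  let _ : Algebra K L := e.toAlgebra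
  let _ : Algebra k L := (e.comp (algebraMap k K)).toAlgebra
  have : IsScalarTower k K L := .of_algebraMap_eq fun _ => rfl
  let d : Derivation k K L := Derivation.mk'
    { toFun := fun f => D (e f)
      map_add' := fun f g => by rw [map_add, map_add]
      map_smul' := fun c f => by
        rw [Algebra.smul_def, map_mul, hD, hc, mul_zero, add_zero, RingHom.id_apply,
          Algebra.smul_def]
        rfl } fun f g => by
    change D (e (f * g)) = e f * D (e g) + e g * D (e f)
    rw [map_mul, hD]
  have h1 := congrArg d.liftKaehlerDifferential h
  rw [map_smul, map_smul, Derivation.liftKaehlerDifferential_comp_D,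
    Derivation.liftKaehlerDifferential_comp_D] at h1
  exact h1

/-! ### Isogenies and expansions. -/

section Isogeny

variable {a b a' b' : ℂ} {φ : (curve a b).FunctionField →ₐ[ℂ] (curve a' b').FunctionField}
  {ρ : (curve a' b').Point →+ (curve a b).Point}

/-- The pullback of functions under a morphism that respects the invariant differentials is
compatible with expansions. -/
lemma IsExpansion.comp_pullback (hω : pullbackOmega φ = omega (curve a' b'))
    {e : (curve a' b').FunctionField →+* ℂ⸨X⸩} (he : IsExpansion e) :
    IsExpansion (e.comp (φ : (curve a b).FunctionField →+* (curve a' b').FunctionField)) where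
  const c := by
    have : φ (algebraMap _ _ (CoordinateRing.mk (curve a b) (C (C c)))) =
        algebraMap _ _ (CoordinateRing.mk (curve a' b') (C (C c))) := φ.commutes c
    rw [RingHom.comp_apply, RingHom.coe_coe, this, he.const]
  deriv_x := by
    -- Under `e` the form `ω'` becomes `dt`, so the hypothesis says that the derivative of `φ x` is
    -- `2 φ y`.
    have h := kaehler_eq_imp e (laurentD ℂ) laurentD_mul
      (fun c => (congrArg (laurentD ℂ) (he.const c)).trans (laurentD_C c)) hω
    have hy' : e (yFun _) ≠ 0 := (_root_.map_ne_zero e).mpr yFun_ne_zero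
    have hy : e (φ (yFun _)) ≠ 0 :=
      (_root_.map_ne_zero e).mpr ((_root_.map_ne_zero φ).mpr yFun_ne_zero)
    rw [he.deriv_x, map_inv₀, map_inv₀, map_mul, map_mul, map_ofNat] at h
    change laurentD ℂ (e (φ (xFun _))) = 2 * e (φ (yFun _))
    field_simp at h
    exact h

variable [hab : Fact (4 * a ^ 3 + 27 * b ^ 2 ≠ 0)] [hab' : Fact (4 * a' ^ 3 + 27 * b' ^ 2 ≠ 0)]

omit hab in
lemma exists_series_of_hasValueAt {u v c : ℂ} (h : (curve a' b').Nonsingular u v)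
    {f : (curve a' b').FunctionField} (hf : HasValueAt f u v c) :
    ∃ p : PowerSeries ℂ, PowerSeries.constantCoeff p = c ∧
      expansionAt (.some u v h) f = ofPowerSeries ℤ ℂ p := by
  obtain ⟨F, G, hG, hFG, hf⟩ := hf
  obtain ⟨ε, hε⟩ := exists_isSeriesAt h
  set γ := ε (CoordinateRing.mk _ G) with hγ
  have hG' : PowerSeries.constantCoeff γ ≠ 0 := by rwa [hγ, hε.constantCoeff]
  refine ⟨ε (CoordinateRing.mk _ F) * γ⁻¹, ?_, ?_⟩
  · rw [map_mul, hε.constantCoeff, PowerSeries.constantCoeff_inv, hγ, hε.constantCoeff, hFG,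
      mul_inv_cancel_right₀ hG]
  · have h1 := congrArg (expansionAt (.some u v h)) hf
    rw [map_mul, ← hε.coe, ← hε.coe] at h1
    have h2 : ofPowerSeries ℤ ℂ γ * ofPowerSeries ℤ ℂ γ⁻¹ = 1 := by
      rw [← map_mul, PowerSeries.mul_inv_cancel γ hG', map_one]
    rw [map_mul, ← h1, mul_assoc, h2, mul_one]

omit hab in
lemma hasValueAt_of_series {u v : ℂ} (h : (curve a' b').Nonsingular u v)
    {f : (curve a' b').FunctionField} {p : PowerSeries ℂ}
    (hf : expansionAt (.some u v h) f = ofPowerSeries ℤ ℂ p) :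
    HasValueAt f u v (PowerSeries.constantCoeff p) := by
  obtain ⟨ε, hε⟩ := exists_isSeriesAt h
  obtain ⟨F, G, hG, hFG⟩ := hε.exists_fraction (hf ▸ order_ofPowerSeries_nonneg p)
  obtain ⟨F, rfl⟩ := AdjoinRoot.mk_surjective F
  obtain ⟨G, rfl⟩ := AdjoinRoot.mk_surjective G
  rw [hε.constantCoeff] at hG
  refine ⟨F, G, hG, ?_, hFG⟩
  have h1 := congrArg (expansionAt (.some u v h)) hFG
  rw [map_mul, hf, ← hε.coe, ← hε.coe, ← map_mul, ofPowerSeries_inj] at h1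
  rw [← hε.constantCoeff, ← hε.constantCoeff]
  exact (congrArg PowerSeries.constantCoeff h1).symm.trans (map_mul _ _ _)

/-- At an affine point `R`, the expansion of the pullback of a function is the expansion of the
function at `ρ R`. -/
lemma expansionAt_comp_affine (hω : pullbackOmega φ = omega (curve a' b')) (hρ : IsIsogeny ρ φ)
    {R : (curve a' b').Point} (hR : R ≠ 0) (f : (curve a b).FunctionField) :
    expansionAt R (φ f) = expansionAt (ρ R) f := by
  have hexp := (isExpansion_expansionAt R).comp_pullback hω
  suffices h : IsCentered ((expansionAt R).comp
      (φ : (curve a b).FunctionField →+* (curve a' b').FunctionField)) (ρ R) from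
    RingHom.congr_fun (h.eq_expansionAt hexp) f
  rcases R with _ | ⟨u, v, h⟩
  · exact absurd rfl hR
  rcases hQ : ρ (.some u v h) with _ | ⟨c, d, hcd⟩
  -- Here `ρ R = 0`. The composite is centered somewhere, and an affine center would be the value of
  -- `ρ` at `R`.
  · obtain ⟨_ | ⟨c, d, hcd⟩, hC⟩ := hexp.exists_isCentered
    · exact hC
    · exfalso
      obtain ⟨p, q, hp, hq, hx, hy⟩ := hC
      have := (hρ u v h c d hcd).mpr ⟨hp ▸ hasValueAt_of_series h hx,
        hq ▸ hasValueAt_of_series h hy⟩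
      rw [this] at hQ
      cases hQ
  · obtain ⟨h1, h2⟩ := (hρ u v h c d hcd).mp hQ
    obtain ⟨p, hp, hx⟩ := exists_series_of_hasValueAt h h1
    obtain ⟨q, hq, hy⟩ := exists_series_of_hasValueAt h h2
    exact ⟨p, q, hp, hq, hx, hy⟩

/-- At a nonzero kernel point the pullback of `x` has a pole, so its denominator vanishes there,
which leaves finitely many `x`-coordinates. As `xCoord 0` is `0`, the function `xSub 0` is `x`
itself. -/
lemma finite_kernel (hω : pullbackOmega φ = omega (curve a' b')) (hρ : IsIsogeny ρ φ) :
    {R : (curve a' b').Point | ρ R = 0}.Finite := by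
  obtain ⟨⟨F, G⟩, hFG⟩ :=
    IsLocalization.surj (nonZeroDivisors (curve a' b').CoordinateRing) (φ (xSub 0))
  replace hFG : φ (xSub 0) * algebraMap _ _ (G : (curve a' b').CoordinateRing) =
    algebraMap _ _ F := hFG
  obtain ⟨H, N, hN, hGH⟩ := exists_mul_eq_polynomial (nonZeroDivisors.ne_zero G.2)
  have hfin : (⋃ r ∈ (N.roots.toFinset : Set ℂ),
      {P : (curve a' b').Point | P ≠ 0 ∧ xCoord P = r}).Finite :=
    (Finset.finite_toSet _).biUnion fun r _ => finite_xCoord_fiber r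
  refine (hfin.insert 0).subset fun R hR => ?_
  by_cases hR0 : R = 0
  · exact Or.inl hR0
  right
  have hpole : (expansionAt R (φ (xSub 0))).order = -2 := by
    rw [expansionAt_comp_affine hω hρ hR0, show ρ R = 0 from hR]
    exact (infinity_x_sub _).1
  rcases R with _ | ⟨u, v, h⟩
  · exact absurd rfl hR0
  simp only [Set.mem_iUnion]
  refine ⟨u, ?_, hR0, rfl⟩
  rw [Finset.mem_coe, Multiset.mem_toFinset, mem_roots hN]
  obtain ⟨ε, hε⟩ := exists_isSeriesAt h
  have hG0 : PowerSeries.constantCoeff (ε G) = 0 := by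
    by_contra hG
    have h1 := congrArg (expansionAt (.some u v h)) hFG
    have hG1 : ofPowerSeries ℤ ℂ (ε G) ≠ 0 := ofPowerSeries_ne_zero fun h0 => hG (by simp [h0])
    rw [map_mul, ← hε.coe, ← hε.coe] at h1
    have h2 := congrArg HahnSeries.order h1
    rw [HahnSeries.order_mul (fun h0 => by rw [h0, HahnSeries.order_zero] at hpole; omega) hG1,
      hpole, order_ofPowerSeries_unit (PowerSeries.isUnit_iff_constantCoeff.mpr (Ne.isUnit hG))]
      at h2
    have := order_ofPowerSeries_nonneg (ε F)
    omega
  have h3 := congrArg (fun g => PowerSeries.constantCoeff (ε g)) hGH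
  simp only [map_mul, hG0, zero_mul, hε.constantCoeff, evalEval_C] at h3
  exact h3.symm

lemma finite_fiber (hω : pullbackOmega φ = omega (curve a' b')) (hρ : IsIsogeny ρ φ)
    (p : (curve a b).Point) : {R : (curve a' b').Point | ρ R = p}.Finite := by
  by_cases h : ∃ R, ρ R = p
  · obtain ⟨S, rfl⟩ := h
    refine ((finite_kernel hω hρ).image (S + ·)).subset fun R hR => ?_
    exact ⟨R - S, by simp only [Set.mem_ofPred_eq] at hR ⊢; rw [map_sub, hR, sub_self], by simp⟩
  · exact Set.finite_empty.subset fun R hR => h ⟨R, hR⟩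

/-- The points with a given image. -/
noncomputable def fiber (hω : pullbackOmega φ = omega (curve a' b')) (hρ : IsIsogeny ρ φ)
    (p : (curve a b).Point) : Finset (curve a' b').Point :=
  (finite_fiber hω hρ p).toFinset

/-- The points other than `0` with image `0`. -/
noncomputable def puncturedKernel (hω : pullbackOmega φ = omega (curve a' b'))
    (hρ : IsIsogeny ρ φ) : Finset (curve a' b').Point :=
  open Classical in (fiber hω hρ 0).erase 0

section

variable (hω : pullbackOmega φ = omega (curve a' b')) (hρ : IsIsogeny ρ φ)

lemma mem_fiber {p : (curve a b).Point} {R : (curve a' b').Point} :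
    R ∈ fiber hω hρ p ↔ ρ R = p := by
  rw [fiber, Set.Finite.mem_toFinset, Set.mem_ofPred_eq]

lemma mem_puncturedKernel {R : (curve a' b').Point} :
    R ∈ puncturedKernel hω hρ ↔ R ≠ 0 ∧ ρ R = 0 := by
  rw [puncturedKernel, Finset.mem_erase, mem_fiber]

lemma sum_mult_fiber (p : (curve a b).Point) (R : (curve a' b').Point) :
    ∑ S ∈ fiber hω hρ p, mult R S = mult (ρ R) p := by
  classical
  rw [sum_mult]
  simp only [mem_fiber, mult]

lemma sum_mult_puncturedKernel {R : (curve a' b').Point} (hR : R ≠ 0) :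
    ∑ S ∈ puncturedKernel hω hρ, mult R S = mult (ρ R) 0 := by
  classical
  rw [sum_mult]
  simp only [mem_puncturedKernel, mult, hR, ne_eq, not_false_eq_true, true_and]

lemma card_fiber (A : (curve a' b').Point) :
    (fiber hω hρ (ρ A)).card = (puncturedKernel hω hρ).card + 1 := by
  classical
  rw [puncturedKernel, Finset.card_erase_add_one ((mem_fiber hω hρ).mpr (map_zero ρ))]
  refine Finset.card_bij (fun R _ => R - A) (fun R hR => ?_) (fun R _ S _ h => sub_left_injective h)
    fun R hR => ⟨R + A, ?_, by simp⟩
  · rw [mem_fiber] at hR ⊢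
    rw [map_sub, hR, sub_self]
  · rw [mem_fiber] at hR ⊢
    rw [map_add, hR, zero_add]

include hω hρ in
/-- The order of the pullback of `x - x(A)` at affine points. -/
lemma order_pullback_xSub {R : (curve a' b').Point} (hR : R ≠ 0) {A : (curve a b).Point}
    (hA : A ≠ 0) : (expansionAt R (φ (xSub A))).order =
      mult (ρ R) A + mult (ρ R) (-A) - 2 * mult (ρ R) 0 := by
  rw [expansionAt_comp_affine hω hρ hR]
  by_cases h : ρ R = 0
  · rw [h]
    have h1 : mult 0 A = 0 := if_neg hA.symm
    have h2 : mult 0 (-A) = 0 := if_neg (neg_ne_zero.mpr hA).symm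
    have h3 : mult (0 : (curve a b).Point) 0 = 1 := if_pos rfl
    rw [h1, h2, h3]
    exact (infinity_x_sub _).1
  · have h3 : mult (ρ R) 0 = 0 := if_neg h
    rw [order_xSub h hA, h3]
    ring

/-- Away from the origin, the pullback of `x - x_A` vanishes on the fibers of `±A` and has double
poles on the kernel, just as the quotient of the two products of functions `x - x_S`. -/
lemma order_pullback_xSub_add_sum {R : (curve a' b').Point} (hR : R ≠ 0)
    {A : (curve a b).Point} (hA : A ≠ 0) : (expansionAt R (φ (xSub A))).order +
      ∑ S ∈ puncturedKernel hω hρ, (expansionAt R (xSub S)).order =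
        ∑ S ∈ fiber hω hρ A, (expansionAt R (xSub S)).order := by
  have e0 : mult (-ρ R) 0 = mult (ρ R) 0 := by rw [← mult_neg, neg_zero]
  have e1 : ∑ S ∈ puncturedKernel hω hρ, (expansionAt R (xSub S)).order =
      2 * mult (ρ R) 0 := by
    rw [Finset.sum_congr rfl fun S hS => order_xSub hR ((mem_puncturedKernel hω hρ).mp hS).1,
      Finset.sum_add_distrib]
    simp only [mult_neg]
    rw [← Nat.cast_sum, ← Nat.cast_sum, sum_mult_puncturedKernel hω hρ hR,
      sum_mult_puncturedKernel hω hρ (neg_ne_zero.mpr hR), map_neg, e0]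
    ring
  have e2 : ∑ S ∈ fiber hω hρ A, (expansionAt R (xSub S)).order =
      mult (ρ R) A + mult (ρ R) (-A) := by
    rw [Finset.sum_congr rfl fun S hS => order_xSub hR (A := S) (by
        rintro rfl
        exact hA (by rw [← (mem_fiber hω hρ).mp hS, map_zero])), Finset.sum_add_distrib]
    simp only [mult_neg]
    rw [← Nat.cast_sum, ← Nat.cast_sum, sum_mult_fiber, sum_mult_fiber, map_neg]
  rw [e1, e2, order_pullback_xSub hω hρ hR hA]
  ring

include hω hρ in
-- `IsIsogeny` only describes the morphism at affine points, so its value `Q` at the origin must be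
-- shown to be `0`. The pullback of `x - x_A` is compared at infinity with a function having the
-- same affine divisor.
lemma expansionAt_comp_zero (f : (curve a b).FunctionField) :
    expansionAt (0 : (curve a' b').Point) (φ f) = expansionAt (0 : (curve a b).Point) f := by
  have hexp := (isExpansion_expansionAt (0 : (curve a' b').Point)).comp_pullback hω
  obtain ⟨Q, hQ⟩ := hexp.exists_isCentered
  have hQe := RingHom.congr_fun (hQ.eq_expansionAt hexp)
  suffices h : Q = 0 by rw [← h]; exact hQe f
  by_contra hQ0
  have hinf := infinite_point (a := a') (b := b')
  -- `A = ρ B` avoids `0` and `±Q`. Taking it in the image makes its fiber a coset of the kernel, so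
  -- the fiber has one element more than the punctured kernel.
  obtain ⟨B, hB⟩ : ∃ B, B ∉ fiber hω hρ 0 ∪ (fiber hω hρ Q ∪ fiber hω hρ (-Q)) := by
    classical
    exact Infinite.exists_notMem_finset _
  simp only [Finset.mem_union, mem_fiber, not_or] at hB
  obtain ⟨hA, hAQ, hAQ'⟩ := hB
  have hne : ∀ s : Finset (curve a' b').Point, ∏ S ∈ s, xSub S ≠ 0 := fun s =>
    Finset.prod_ne_zero_iff.mpr fun S _ => xSub_ne_zero S
  have hφ : φ (xSub (ρ B)) ≠ 0 := (_root_.map_ne_zero φ).mpr (xSub_ne_zero _)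
  have hprod : ∀ (R : (curve a' b').Point) (s : Finset (curve a' b').Point),
      (expansionAt R (∏ S ∈ s, xSub S)).order = ∑ S ∈ s, (expansionAt R (xSub S)).order :=
    fun R s => by
      rw [map_prod, order_prod _ _ fun S _ => expansionAt_ne_zero R (xSub_ne_zero S)]
  have h0 : ∀ S : (curve a' b').Point,
      (expansionAt (0 : (curve a' b').Point) (xSub S)).order = -2 := fun S => (infinity_x_sub _).1
  have hmul : ∀ R : (curve a' b').Point,
      (expansionAt R (φ (xSub (ρ B)) * ∏ S ∈ puncturedKernel hω hρ, xSub S)).order =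
        (expansionAt R (φ (xSub (ρ B)))).order +
          ∑ S ∈ puncturedKernel hω hρ, (expansionAt R (xSub S)).order := fun R => by
    rw [map_mul, HahnSeries.order_mul (expansionAt_ne_zero R hφ) (expansionAt_ne_zero R (hne _)),
      hprod]
  have key := (infinity_eq_of_order_eq (mul_ne_zero hφ (hne (puncturedKernel hω hρ)))
    (hne (fiber hω hρ (ρ B))) fun R hR => by
      rw [hmul, hprod, order_pullback_xSub_add_sum hω hρ hR hA]).1
  rw [hmul, hprod, Finset.sum_congr rfl fun S _ => h0 S, Finset.sum_congr rfl fun S _ => h0 S,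
    Finset.sum_const, Finset.sum_const, card_fiber] at key
  -- With `k` nonzero kernel points, comparison at infinity gives order `-2(k + 1) + 2k = -2`, but
  -- at `Q ≠ 0, ±A` the function `x - x_A` has order `0`.
  have hQord : (expansionAt (0 : (curve a' b').Point) (φ (xSub (ρ B)))).order = 0 := by
    have h1 : expansionAt (0 : (curve a' b').Point) (φ (xSub (ρ B))) =
      expansionAt Q (xSub (ρ B)) := hQe (xSub (ρ B))
    have h2 : mult Q (ρ B) = 0 := if_neg fun h => hAQ h.symm
    have h3 : mult Q (-ρ B) = 0 := if_neg fun h => hAQ' (by rw [h, neg_neg])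
    rw [h1, order_xSub hQ0 hA, h2, h3]
    rfl
  rw [hQord] at key
  simp only [nsmul_eq_mul] at key
  push_cast at key
  omega

end

end Isogeny

/-! ### Summation over the fibers of an isogeny. -/

section IsogenySum

variable {a b a' b' : ℂ} {φ : (curve a b).FunctionField →ₐ[ℂ] (curve a' b').FunctionField}
  {ρ : (curve a' b').Point →+ (curve a b).Point}
  [hab : Fact (4 * a ^ 3 + 27 * b ^ 2 ≠ 0)] [hab' : Fact (4 * a' ^ 3 + 27 * b' ^ 2 ≠ 0)]
  (hω : pullbackOmega φ = omega (curve a' b')) (hρ : IsIsogeny ρ φ)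

include hω hρ in
/-- The order of the pullback of the function cutting out `[p] + [q] + [r]` at affine points. -/
lemma order_pullback_line {R : (curve a' b').Point} (hR : R ≠ 0) {p q r : (curve a b).Point}
    (hp : p ≠ 0) (hq : q ≠ 0) (hr : r ≠ 0) {s t : ℂ} (hst : CutsOut s t p q r) :
    (expansionAt R (φ (line a b s t))).order =
      mult (ρ R) p + mult (ρ R) q + mult (ρ R) r - 3 * mult (ρ R) 0 := by
  rw [expansionAt_comp_affine hω hρ hR]
  by_cases h : ρ R = 0
  · rw [h]
    have h1 : ∀ {A : (curve a b).Point}, A ≠ 0 → mult 0 A = 0 := fun hA => if_neg hA.symm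
    have h3 : mult (0 : (curve a b).Point) 0 = 1 := if_pos rfl
    rw [h1 hp, h1 hq, h1 hr, h3]
    exact (infinity_line s t).1
  · have h3 : mult (ρ R) 0 = 0 := if_neg h
    rw [order_line h hst, h3]
    ring

/-- The product of the generators over a finite set of points. -/
noncomputable def generatorProd (n : ℕ) (s : Finset (curve a' b').Point) :
    (curve a' b').FunctionField :=
  ∏ S ∈ s, algebraMap _ _ (generator n S)

omit hab' in
lemma generatorProd_ne_zero (n : ℕ) (s : Finset (curve a' b').Point) : generatorProd n s ≠ 0 :=
  Finset.prod_ne_zero_iff.mpr fun S _ => algebraMap_ne_zero (generator_ne_zero n S)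

lemma order_generatorProd {n : ℕ} {s : Finset (curve a' b').Point} (hs : ∀ S ∈ s, n • S = 0)
    {R : (curve a' b').Point} (hR : R ≠ 0) :
    (expansionAt R (generatorProd n s)).order = n * (∑ S ∈ s, mult R S : ℕ) := by
  rw [generatorProd, map_prod, order_prod _ _ fun S _ =>
    expansionAt_algebraMap_ne_zero R (generator_ne_zero n S),
    Finset.sum_congr rfl fun S hS => order_generator hR (hs S hS), ← Finset.mul_sum]
  push_cast
  rfl

lemma logCoeff_generatorProd (n : ℕ) (s : Finset (curve a' b').Point) :
    logCoeff (expansionAt (0 : (curve a' b').Point) (generatorProd n s)) =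
      ∑ S ∈ s, generatorSlope n S := by
  rw [generatorProd, map_prod, logCoeff_prod _ _ fun S _ =>
    expansionAt_algebraMap_ne_zero _ (generator_ne_zero n S)]
  rfl

/-- The punctured kernel is stable under negation and the slopes are odd, so the sum equals its own
negative. -/
lemma sum_generatorSlope_puncturedKernel {n : ℕ} (hn : ∀ S, ρ S = 0 → n • S = 0) :
    ∑ S ∈ puncturedKernel hω hρ, generatorSlope n S = 0 := by
  have h1 : ∑ S ∈ puncturedKernel hω hρ, generatorSlope n (-S) =
      ∑ S ∈ puncturedKernel hω hρ, generatorSlope n S := by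
    refine Finset.sum_bij' (fun S _ => -S) (fun S _ => -S) ?_ ?_ ?_ ?_ ?_ <;>
      simp +contextual [mem_puncturedKernel]
  have h2 : ∑ S ∈ puncturedKernel hω hρ, (generatorSlope n S + generatorSlope n (-S)) = 0 :=
    Finset.sum_eq_zero fun S hS => by
      obtain ⟨hS0, hS⟩ := (mem_puncturedKernel hω hρ).mp hS
      exact generatorSlope_add_neg hS0 (hn S hS)
  rw [Finset.sum_add_distrib, h1, ← two_mul] at h2
  exact (mul_eq_zero.mp h2).resolve_left two_ne_zero

/-- The pulled-back line has triple poles at the nonzero kernel points; the cube of the kernel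
product removes those of its `n`-th power. The affine divisor is then that of the product over the
three fibers, and `logCoeff` at infinity is compared. -/
lemma sum_generatorSlope_fiber {n : ℕ} {p q r : (curve a b).Point} (hp : p ≠ 0) (hq : q ≠ 0)
    (hr : r ≠ 0) (hn : ∀ S, ρ S = 0 ∨ ρ S = p ∨ ρ S = q ∨ ρ S = r → n • S = 0) {s t : ℂ}
    (hst : CutsOut s t p q r) :
    ∑ S ∈ fiber hω hρ p, generatorSlope n S + ∑ S ∈ fiber hω hρ q, generatorSlope n S +
      ∑ S ∈ fiber hω hρ r, generatorSlope n S = -(n * s) := by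
  have hφ : φ (line a b s t) ≠ 0 := (_root_.map_ne_zero φ).mpr (lineFun_ne_zero s t)
  have hg := generatorProd_ne_zero (a' := a') (b' := b') n
  have hgp := mul_ne_zero (hg (fiber hω hρ p)) (hg (fiber hω hρ q))
  have hK := hg (puncturedKernel hω hρ)
  have key := (infinity_eq_of_order_eq (mul_ne_zero (pow_ne_zero n hφ) (pow_ne_zero 3 hK))
    (mul_ne_zero hgp (hg (fiber hω hρ r))) fun R hR => by
      have e : ∀ {f : (curve a' b').FunctionField}, f ≠ 0 → expansionAt R f ≠ 0 :=
        fun hf => expansionAt_ne_zero R hf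
      simp only [map_mul, map_pow]
      rw [HahnSeries.order_mul (pow_ne_zero n (e hφ)) (pow_ne_zero 3 (e hK)),
        HahnSeries.order_mul (mul_ne_zero (e (hg _)) (e (hg _))) (e (hg _)),
        HahnSeries.order_mul (e (hg _)) (e (hg _)), HahnSeries.order_pow, HahnSeries.order_pow,
        order_pullback_line hω hρ hR hp hq hr hst,
        order_generatorProd
          (fun S hS => hn S (Or.inl ((mem_puncturedKernel hω hρ).mp hS).2)) hR,
        order_generatorProd
          (fun S hS => hn S (Or.inr (Or.inl ((mem_fiber hω hρ).mp hS)))) hR,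
        order_generatorProd
          (fun S hS => hn S (Or.inr (Or.inr (Or.inl ((mem_fiber hω hρ).mp hS))))) hR,
        order_generatorProd
          (fun S hS => hn S (Or.inr (Or.inr (Or.inr ((mem_fiber hω hρ).mp hS))))) hR,
        sum_mult_puncturedKernel hω hρ hR, sum_mult_fiber, sum_mult_fiber, sum_mult_fiber,
        nsmul_eq_mul, nsmul_eq_mul]
      push_cast
      ring).2
  have e : ∀ {f : (curve a' b').FunctionField}, f ≠ 0 →
      expansionAt (0 : (curve a' b').Point) f ≠ 0 := fun hf => expansionAt_ne_zero _ hf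
  simp only [map_mul, map_pow] at key
  rw [logCoeff_mul (pow_ne_zero n (e hφ)) (pow_ne_zero 3 (e hK)),
    logCoeff_mul (mul_ne_zero (e (hg _)) (e (hg _))) (e (hg _)),
    logCoeff_mul (e (hg _)) (e (hg _)), logCoeff_pow (e hφ), logCoeff_pow (e hK),
    logCoeff_generatorProd, logCoeff_generatorProd, logCoeff_generatorProd,
    logCoeff_generatorProd, sum_generatorSlope_puncturedKernel hω hρ fun S hS => hn S (Or.inl hS),
    expansionAt_comp_zero hω hρ, line, (infinity_line s t).2] at key
  linear_combination -key

include hω hρ in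
lemma finite_comap (Z : AddSubgroup (curve a b).Point) [Finite Z] : Finite (Z.comap ρ) := by
  have h : (⋃ p ∈ (Z : Set (curve a b).Point), {R : (curve a' b').Point | ρ R = p}).Finite :=
    (Set.toFinite (Z : Set (curve a b).Point)).biUnion fun p _ => finite_fiber hω hρ p
  refine (h.subset fun R hR => ?_).to_subtype
  simp only [Set.mem_iUnion]
  exact ⟨ρ R, hR, rfl⟩

/-- The sums of the slope function over the fibers of an isogeny form a slope function. -/
lemma isSlopeFunction_sum_fiber (Z : AddSubgroup (curve a b).Point) [Finite (Z.comap ρ)] :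
    IsSlopeFunction Z fun p => ∑ S ∈ fiber hω hρ (p : (curve a b).Point),
      -generatorSlope (Nat.card (Z.comap ρ)) S / Nat.card (Z.comap ρ) := by
  have hn : ∀ p ∈ Z, ∀ S, ρ S = p → Nat.card (Z.comap ρ) • S = 0 := fun p hp S hS =>
    card_nsmul_eq_zero_of_mem (Z.comap ρ) (AddSubgroup.mem_comap.mpr (hS ▸ hp))
  have hn0 : (Nat.card (Z.comap ρ) : ℂ) ≠ 0 := Nat.cast_ne_zero.mpr Nat.card_pos.ne'
  refine ⟨fun p q hpq => ?_, fun p q r _ s t hst => ?_⟩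
  · have h1 : ∀ f : (curve a' b').Point → ℂ, ∑ S ∈ fiber hω hρ (q : (curve a b).Point), f S =
        ∑ S ∈ fiber hω hρ (p : (curve a b).Point), f (-S) := fun f => by
      refine Finset.sum_bij' (fun S _ => -S) (fun S _ => -S) ?_ ?_ ?_ ?_ ?_ <;>
        simp +contextual [mem_fiber, hpq]
    rw [h1, ← Finset.sum_add_distrib]
    refine Finset.sum_eq_zero fun S hS => ?_
    rw [mem_fiber] at hS
    have hS0 : S ≠ 0 := by
      rintro rfl
      exact p.2.2 (by rw [← hS, map_zero])
    have := generatorSlope_add_neg hS0 (hn p p.2.1 S hS)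
    rw [← add_div, div_eq_zero_iff]
    left
    linear_combination -this
  · have := sum_generatorSlope_fiber hω hρ p.2.2 q.2.2 r.2.2 (n := Nat.card (Z.comap ρ))
      (by
        rintro S (hS | hS | hS | hS)
        · exact hn 0 Z.zero_mem S hS
        · exact hn _ p.2.1 S hS
        · exact hn _ q.2.1 S hS
        · exact hn _ r.2.1 S hS) hst
    rw [← Finset.sum_div, ← Finset.sum_div, ← Finset.sum_div, Finset.sum_neg_distrib,
      Finset.sum_neg_distrib, Finset.sum_neg_distrib]
    field_simp
    linear_combination -this

lemma finsum_eq_sum_fiber (Z : AddSubgroup (curve a b).Point) (p : Punctured Z)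
    (F : (curve a' b').Point → ℂ) :
    ∑ᶠ p' : {p' : Punctured (Z.comap ρ) // ρ (p' : (curve a' b').Point) = p}, F p'.1.1 =
      ∑ S ∈ fiber hω hρ (p : (curve a b).Point), F S := by
  have he : Function.Bijective
      (fun p' : {p' : Punctured (Z.comap ρ) // ρ (p' : (curve a' b').Point) = p} =>
        (⟨p'.1.1, (mem_fiber hω hρ).mpr p'.2⟩ :
          {S // S ∈ fiber hω hρ (p : (curve a b).Point)})) := by
    refine ⟨fun p' q' h => Subtype.ext (Subtype.ext (Subtype.mk.inj h)), fun S => ?_⟩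
    have hS := (mem_fiber hω hρ).mp S.2
    have hZ : S.1 ∈ Z.comap ρ := by
      rw [AddSubgroup.mem_comap, hS]
      exact p.2.1
    have h0 : S.1 ≠ 0 := by
      intro h0
      rw [h0, map_zero] at hS
      exact p.2.2 hS.symm
    exact ⟨⟨⟨S.1, hZ, h0⟩, hS⟩, rfl⟩
  rw [finsum_eq_of_bijective (g := fun S => F S.1) _ he fun _ => rfl,
    finsum_eq_sum_of_fintype, Finset.sum_coe_sort (fiber hω hρ (p : (curve a b).Point)) F]

include hω hρ in
-- By uniqueness on `ρ⁻¹(Z)`, `z'` is the explicit slope function; its fiber sums form a slope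
-- function on `Z`, which by uniqueness is `z`.
theorem slopeFunction_eq_finsum (Z : AddSubgroup (curve a b).Point) [Finite Z]
    {z : Punctured Z → ℂ} {z' : Punctured (Z.comap ρ) → ℂ} (hz : IsSlopeFunction Z z)
    (hz' : IsSlopeFunction (Z.comap ρ) z') (p : Punctured Z) :
    z p = ∑ᶠ p' : {p' : Punctured (Z.comap ρ) // ρ (p' : (curve a' b').Point) = p}, z' p' := by
  have := finite_comap hω hρ Z
  rw [hz.unique (isSlopeFunction_sum_fiber hω hρ Z),
    hz'.unique (isSlopeFunction_generatorSlope (Z.comap ρ))]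
  exact (finsum_eq_sum_fiber hω hρ Z p fun S =>
    -generatorSlope (Nat.card (Z.comap ρ)) S / Nat.card (Z.comap ρ)).symm

end IsogenySum

end LineSlope

theorem mainTheorem6 (a b : ℂ) (hab : 4 * a ^ 3 + 27 * b ^ 2 ≠ 0)
    (Z : AddSubgroup (LineSlope.curve a b).Point) (hZ : Finite Z) :
    -- the line through each triple exists and is unique
    (∀ p q r : LineSlope.Punctured Z, (p : (LineSlope.curve a b).Point) + q + r = 0 →
      ∃! l : ℂ × ℂ, LineSlope.CutsOut l.1 l.2 (p : (LineSlope.curve a b).Point) q r) ∧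
    -- existence and uniqueness of `z`
    (∃! z : LineSlope.Punctured Z → ℂ, LineSlope.IsSlopeFunction Z z) ∧
    -- `x_p + x_q + x_r = s ^ 2`
    (∀ p q r : LineSlope.Punctured Z, (p : (LineSlope.curve a b).Point) + q + r = 0 →
      ∀ s t : ℂ, LineSlope.CutsOut s t (p : (LineSlope.curve a b).Point) q r →
        LineSlope.xCoord (p : (LineSlope.curve a b).Point) + LineSlope.xCoord q.1 +
          LineSlope.xCoord r.1 = s ^ 2) ∧
    -- compatibility with isogenies
    (∀ a' b' : ℂ, 4 * a' ^ 3 + 27 * b' ^ 2 ≠ 0 →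
      ∀ (ρ : (LineSlope.curve a' b').Point →+ (LineSlope.curve a b).Point)
        (φ : (LineSlope.curve a b).FunctionField →ₐ[ℂ] (LineSlope.curve a' b').FunctionField),
        LineSlope.IsIsogeny ρ φ →
        LineSlope.pullbackOmega φ = LineSlope.omega (LineSlope.curve a' b') →
        Finite (Z.comap ρ) ∧
        ∀ (z : LineSlope.Punctured Z → ℂ) (z' : LineSlope.Punctured (Z.comap ρ) → ℂ),
          LineSlope.IsSlopeFunction Z z → LineSlope.IsSlopeFunction (Z.comap ρ) z' →
          ∀ p : LineSlope.Punctured Z,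
            z p = ∑ᶠ p' : {p' : LineSlope.Punctured (Z.comap ρ) //
              ρ (p' : (LineSlope.curve a' b').Point) = p}, z' p') := by
  have hab' : Fact (4 * a ^ 3 + 27 * b ^ 2 ≠ 0) := ⟨hab⟩
  refine ⟨fun p q r h => ?_, ?_, fun p q r h s t hst => ?_, fun a' b' hab₁ ρ φ hρ hω => ?_⟩
  · obtain ⟨s, t, hst, -⟩ := LineSlope.exists_cutsOut p.2.2 q.2.2 r.2.2 h
    refine ⟨(s, t), hst, fun l hl => ?_⟩
    obtain ⟨h1, h2⟩ := LineSlope.line_unique (hl.trans hst.symm)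
    exact Prod.ext h1 h2
  · exact ⟨_, LineSlope.isSlopeFunction_generatorSlope Z,
      fun z hz => hz.unique (LineSlope.isSlopeFunction_generatorSlope Z)⟩
  · obtain ⟨s', t', hst', hx⟩ := LineSlope.exists_cutsOut p.2.2 q.2.2 r.2.2 h
    rw [hx, (LineSlope.line_unique (hst.trans hst'.symm)).1]
  · have hab₂ : Fact (4 * a' ^ 3 + 27 * b' ^ 2 ≠ 0) := ⟨hab₁⟩
    exact ⟨LineSlope.finite_comap hω hρ Z,
      fun z z' hz hz' p => LineSlope.slopeFunction_eq_finsum hω hρ Z hz hz' p⟩
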